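/- **Setting.** Let $G=(V,E)$ be an infinite, connected, locally finite simple graph, $N_y$ the set of neighbours of $y$, and for finite $\Lambda\subset V$ let $\vec\partial\Lambda$ be the set of vertices outside $\Lambda$ with a neighbour in $\Lambda$ and $\bar\Lambda=\Lambda\cup\vec\partial\Lambda$. Fix a root $y_1\in V$; put $V_{0,1}=\{y_1\}$, $V_n=\bigcup_{y\in V_{0,n}}(\{y\}\cup N_y)$, $V_{0,n+1}=V_{0,n}\cup\vec\partial V_n$, and $V_0=\bigcup_n V_{0,n}$ (the tessellation). Assume that no $y\in V_0$ lies in the plaquette $\{z\}\cup N_z$ of another point $z\in V_0$. Each $x\in V$ carries the algebra $\mathcal A_x=\mathcal B(\mathcal H_x)$ of a finite-dimensional Hilbert space, with a state $\varphi^0_x$. Let $\mathcal A_V=\bigotimes_{x\in V}\mathcal A_x$ be the quasi-local $C^*$-algebra, $\mathcal A_\Lambda\subset\mathcal A_V$ the subalgebra of $\Lambda\subset V$, and $\varphi^0=\bigotimes_x\varphi^0_x$ the product state, that is, the unique state of $\mathcal A_V$ with $\varphi^0(\prod_{x\in\Lambda}a_x)=\prod_{x\in\Lambda}\varphi^0_x(a_x)$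 for finite $\Lambda$ and $a_x\in\mathcal A_x$. For finite $\Lambda$ let $\mathbb E^0_{\Lambda^c}$ be the composition over $x\in\Lambda$ of the commuting maps $\mathbb E^0_{\{x\}^c}(a_x\otimes b)=\varphi^0_x(a_x)\,b$. For $y\in V_0$ and $x\in N_y$ let $\tilde K_{(x,y)}\in\mathcal A_{\{x,y\}}$ be invertible, such that the $C^*$-algebra $\mathcal K$ generated by all these operators is commutative. Let $B_{N_y}=\mathbb E^0_{\{y\}^c}\big(|\prod_{x\in N_y}\tilde K_{(x,y)}|^2\big)$, assume that $B_{N_y}$ commutes with $\mathcal K$ for every $y\in V_0$, and put $$K_{\{y\}\cup N_y}=\Big(\prod_{x\in N_y}\tilde K_{(x,y)}\Big)B_{N_y}^{-1/2},\qquad K_\Lambda=\prod_{y\in\Lambda\cap V_0}K_{\{y\}\cup N_y}\quad(\Lambda\subset V\text{ finite}).$$ Then the operators $K_{\{y\}\cup N_y}$ ($y\in V_0$) and their adjoints commute. A *quasi-conditional expectation* with respect to unital $C^*$-algebras $C\subset B\subset A$ is a completely positive unital map $E:A\to B$ with $E(ca)=cE(a)$ for $c\in C$, $a\in A$. Call a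 sequence $(\Lambda_n)_{n\ge0}$ of finite subsets of $V$, not all empty, *admissible* if $\bar\Lambda_n\subset\Lambda_{n+1}$ and $\vec\partial\Lambda_n\cap V_0=\emptyset$ for all $n$. A state $\varphi$ on $\mathcal A_V$ is a *backward quantum Markov field with respect to $V_0$* if for every admissible sequence there are a state $\psi$ and unital completely positive maps $E_n:\mathcal A_V\to\mathcal A_V$ such that $E_n(ca)=cE_n(a)$ for $c\in\mathcal A_{\Lambda_n}$ and $a\in\mathcal A_V$, such that $E_n$ restricts to a quasi-conditional expectation with respect to $\mathcal A_{\Lambda_n}\subset\mathcal A_{\bar\Lambda_n}\subset\mathcal A_{\bar\Lambda_{n+1}}$, and such that $\varphi=\lim_n\psi\circ E_0\circ E_1\circ\dots\circ E_n$ in the weak-* topology. **Theorem.** For every finite $\Lambda\subset V$ the functional $\tilde\varphi_\Lambda(a)=\varphi^0(K_\Lambda^*\,a\,K_\Lambda)$ is a state on $\mathcal A_V$. The net $(\tilde\varphi_\Lambda)$, indexed by the finite subsets of $V$ ordered by inclusion, converges in the weak-* topology to a state $\varphi$; more precisely $\tilde\varphi_\Lambda(a)=\varphi(a)$ for all $a\in\mathcal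 A_{\Lambda_0}$ and all finite $\Lambda\supseteq\bar\Lambda_0$. The state $\varphi$ is a backward quantum Markov field with respect to $V_0$. Explicitly, for an admissible sequence put $S_n=\Lambda_{n+1}\setminus\bar\Lambda_n$ and $T_n=\bar\Lambda_{n+1}\setminus\bar\Lambda_n$. The maps $E_n(a)=\mathbb E^0_{T_n^c}(K_{S_n}^*\,a\,K_{S_n})$ have all the properties required of the $E_n$ in the definition above, with $\psi=\tilde\varphi_{\Lambda_0}$. The maps $E_{\Lambda_n,\Lambda_{n+1}}(a)=\mathbb E^0_{S_n^c}(K_{S_n}^*\,a\,K_{S_n})$ are unital and completely positive on $\mathcal A_V$, satisfy $E_{\Lambda_n,\Lambda_{n+1}}(ca)=c\,E_{\Lambda_n,\Lambda_{n+1}}(a)$ for $c\in\mathcal A_{\Lambda_n}$, and also satisfy $\varphi=\lim_n\tilde\varphi_{\Lambda_0}\circ E_{\Lambda_0,\Lambda_1}\circ\dots\circ E_{\Lambda_n,\Lambda_{n+1}}$ in the weak-* topology. -/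

import Mathlib

open scoped ComplexOrder lp Topology

noncomputable section

namespace QuantumMarkov

universe u

/-! ### Graphs and tessellations -/

section Graph

variable {V : Type u} (G : SimpleGraph V) [G.LocallyFinite]

open Classical in
/-- External boundary: the vertices outside `Λ` that have a neighbour in `Λ`. -/
def extBoundary (Λ : Finset V) : Finset V := (Λ.biUnion fun x => G.neighborFinset x) \ Λ

open Classical in
/-- Closure `Λ̄`: the set together with its external boundary. -/
def closureFin (Λ : Finset V) : Finset V := Λ ∪ extBoundary G Λ

open Classical in
/-- The plaquette `{y} ∪ N_y`. -/
def plaquette (y : V) : Finset V := insert y (G.neighborFinset y)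

open Classical in
/-- The increasing sets `V_{0,1} = {y₁}`, `V_{0,n+1} = V_{0,n} ∪ (external boundary of V_n)`, where
`V_n` is the union of the plaquettes at the points of `V_{0,n}`; here they are indexed from `0`. -/
def tessLevel (y₁ : V) : ℕ → Finset V
  | 0 => {y₁}
  | n + 1 => tessLevel y₁ n ∪ extBoundary G ((tessLevel y₁ n).biUnion (plaquette G))

/-- The tessellation `V₀` of the graph with root `y₁`. -/
def tessellation (y₁ : V) : Set V := {x | ∃ n, x ∈ tessLevel G y₁ n}

/-- The sequences of finite sets used in the Markov property: the closure of each set is contained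
in the next one, and no external boundary meets `V₀`. The sequence of empty sets is excluded; then
the sets exhaust the (connected) graph. -/
structure IsAdmissible (y₁ : V) (Λ : ℕ → Finset V) : Prop where
  closure_subset : ∀ n, closureFin G (Λ n) ⊆ Λ (n + 1)
  boundary_disjoint : ∀ n, ∀ x ∈ extBoundary G (Λ n), x ∉ tessellation G y₁
  nonempty : ∃ n, (Λ n).Nonempty

end Graph

open Classical in
/-- The product of a finite commuting family (with value `1` if the family does not commute). -/
def commProd {ι M : Type*} [Monoid M] (s : Finset ι) (f : ι → M) : M :=
  if h : (s : Set ι).Pairwise (Function.onFun Commute f) then s.noncommProd f h else 1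

/-- A state: a positive unital linear functional on a unital star algebra. -/
def IsState {A : Type*} [Ring A] [StarRing A] [Algebra ℂ A] (ω : A →ₗ[ℂ] ℂ) : Prop :=
  ω 1 = 1 ∧ ∀ a, 0 ≤ ω (star a * a)

/-! ### The quasi-local algebra

The site `x` carries the Hilbert space `ℂ^{d x}` and the algebra `M_{d x}(ℂ)` of its operators.
The tensor products of these algebras over finite sets act faithfully and compatibly on the Hilbert
space `ℓ²(Ω)` with orthonormal basis the set `Ω` of all configurations: an operator at `x` acts on
the `x`-th coordinate. The quasi-local algebra is the norm closure of the algebra that they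
generate. -/

section Algebra

variable {V : Type u} (d : V → ℕ)

/-- Configurations. -/
abbrev Config : Type u := ∀ x : V, Fin (d x)

/-- The Hilbert space `ℓ²(Ω)`. -/
abbrev ConfigSpace : Type u := lp (fun _ : Config d => ℂ) 2

/-- Operators on the Hilbert space at `x`. -/
abbrev SiteAlg (x : V) : Type := Matrix (Fin (d x)) (Fin (d x)) ℂ

variable {d}

open Classical in
/-- Exchange of the values `i` and `j` at the site `x`. -/
def swapAt (x : V) (i j : Fin (d x)) : Config d ≃ Config d where
  toFun σ := Function.update σ x (Equiv.swap i j (σ x))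
  invFun σ := Function.update σ x (Equiv.swap i j (σ x))
  left_inv σ := by simp
  right_inv σ := by simp

open Classical in
lemma memℓp_unit (x : V) (i j : Fin (d x)) (f : ConfigSpace d) :
    Memℓp (fun σ : Config d => if σ x = i then f (Function.update σ x j) else 0) 2 := by
  have h2 : 0 < (2 : ENNReal).toReal := by norm_num
  have hf := (lp.memℓp f).summable h2
  refine memℓp_gen (Summable.of_nonneg_of_le (fun _ => by positivity) (fun σ => ?_)
    ((swapAt x i j).summable_iff.mpr hf))
  by_cases h : σ x = i
  · simp [swapAt, h]
  · simp only [h, if_false, norm_zero]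
    rw [Real.zero_rpow h2.ne']
    simp only [Function.comp]
    positivity

open Classical in
lemma norm_unit_le (x : V) (i j : Fin (d x)) (f : ConfigSpace d) :
    ‖(⟨_, memℓp_unit x i j f⟩ : ConfigSpace d)‖ ≤ 1 * ‖f‖ := by
  have h2 : 0 < (2 : ENNReal).toReal := by norm_num
  have hf := (lp.memℓp f).summable h2
  rw [one_mul, ← Real.rpow_le_rpow_iff (norm_nonneg _) (norm_nonneg _) h2,
    lp.norm_rpow_eq_tsum h2, lp.norm_rpow_eq_tsum h2,
    ← (swapAt x i j).tsum_eq (fun σ => ‖f σ‖ ^ (2 : ENNReal).toReal)]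
  refine Summable.tsum_le_tsum (fun σ => ?_) ((memℓp_unit x i j f).summable h2)
    ((swapAt x i j).summable_iff.mpr hf)
  by_cases h : σ x = i
  · simp [swapAt, h]
  · simp only [h, if_false, norm_zero]
    rw [Real.zero_rpow h2.ne']
    positivity

open Classical in
/-- The matrix unit `|i⟩⟨j|` at the site `x`, as an operator on `ℓ²(Ω)`. -/
def unitOp (x : V) (i j : Fin (d x)) : ConfigSpace d →L[ℂ] ConfigSpace d :=
  LinearMap.mkContinuous
    { toFun := fun f => ⟨_, memℓp_unit x i j f⟩
      map_add' := fun f g => by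
        ext σ
        change (if σ x = i then (f + g) (Function.update σ x j) else 0) =
          (if σ x = i then f (Function.update σ x j) else 0) +
            (if σ x = i then g (Function.update σ x j) else 0)
        by_cases h : σ x = i <;> simp [h]
      map_smul' := fun c f => by
        ext σ
        by_cases h : σ x = i <;> simp [h] }
    1 (norm_unit_le x i j)

open Classical in
lemma unitOp_apply (x : V) (i j : Fin (d x)) (f : ConfigSpace d) (σ : Config d) :
    unitOp x i j f σ = if σ x = i then f (Function.update σ x j) else 0 := rfl

lemma star_unitOp (x : V) (i j : Fin (d x)) : star (unitOp x i j) = unitOp x j i := by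
  classical
  rw [ContinuousLinearMap.star_eq_adjoint]
  symm
  rw [ContinuousLinearMap.eq_adjoint_iff]
  intro f g
  rw [lp.inner_eq_tsum, lp.inner_eq_tsum,
    ← (swapAt x i j).tsum_eq (fun σ => inner ℂ (unitOp x j i f σ) (g σ))]
  refine tsum_congr fun σ => ?_
  have hs : swapAt x i j σ = Function.update σ x (Equiv.swap i j (σ x)) := rfl
  have hiff : Equiv.swap i j (σ x) = j ↔ σ x = i := by
    rw [Equiv.swap_apply_eq_iff, Equiv.swap_apply_right]
  simp only [unitOp_apply, hs, Function.update_self, hiff, Function.update_idem]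
  by_cases h : σ x = i
  · subst h
    simp
  · simp [h]

/-- An operator at the site `x`, as an operator on `ℓ²(Ω)`. -/
def siteOp (x : V) (m : SiteAlg d x) : ConfigSpace d →L[ℂ] ConfigSpace d :=
  ∑ i, ∑ j, m i j • unitOp x i j

open Classical in
lemma siteOp_apply (x : V) (m : SiteAlg d x) (f : ConfigSpace d) (σ : Config d) :
    siteOp x m f σ = ∑ j, m (σ x) j * f (Function.update σ x j) := by
  simp only [siteOp, sum_apply, smul_apply,
    lp.coeFn_sum, lp.coeFn_smul, Finset.sum_apply, Pi.smul_apply, unitOp_apply, smul_eq_mul]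
  rw [Finset.sum_eq_single (σ x)]
  · simp
  · intro b _ hb
    simp [hb.symm]
  · simp

variable (d) in
/-- The operators on `ℓ²(Ω)` that form the quasi-local algebra. -/
def quasiLocalSubalgebra : StarSubalgebra ℂ (ConfigSpace d →L[ℂ] ConfigSpace d) :=
  (StarAlgebra.adjoin ℂ (⋃ x : V, Set.range (siteOp (d := d) x))).topologicalClosure

instance : IsClosed (quasiLocalSubalgebra d : Set (ConfigSpace d →L[ℂ] ConfigSpace d)) :=
  StarSubalgebra.isClosed_topologicalClosure _

variable (d) in
/-- The quasi-local algebra `𝒜_V`, a C⋆-algebra. -/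
def QuasiLocal : Type u := quasiLocalSubalgebra d

instance : CStarAlgebra (QuasiLocal d) :=
  inferInstanceAs (CStarAlgebra (quasiLocalSubalgebra d))

instance : PartialOrder (QuasiLocal d) := CStarAlgebra.spectralOrder _

instance : StarOrderedRing (QuasiLocal d) := CStarAlgebra.spectralOrderedRing _

lemma siteOp_mem (x : V) (m : SiteAlg d x) : siteOp x m ∈ quasiLocalSubalgebra d :=
  StarSubalgebra.le_topologicalClosure _
    (StarAlgebra.subset_adjoin ℂ _ (Set.mem_iUnion.mpr ⟨x, m, rfl⟩))

/-- The embedding of the algebra at the site `x` into the quasi-local algebra. -/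
def site (x : V) : SiteAlg d x →⋆ₐ[ℂ] QuasiLocal d where
  toFun m := ⟨siteOp x m, siteOp_mem x m⟩
  map_one' := by
    classical
    apply Subtype.ext
    ext f σ
    change siteOp x 1 f σ = f σ
    rw [siteOp_apply]
    simp [Matrix.one_apply]
  map_mul' m n := by
    classical
    apply Subtype.ext
    ext f σ
    change siteOp x (m * n) f σ = siteOp x m (siteOp x n f) σ
    simp only [siteOp_apply, Matrix.mul_apply, Function.update_self, Function.update_idem,
      Finset.sum_mul, Finset.mul_sum]
    rw [Finset.sum_comm]
    simp only [mul_assoc]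
  map_zero' := by
    apply Subtype.ext
    change siteOp x 0 = 0
    simp [siteOp]
  map_add' m n := by
    apply Subtype.ext
    change siteOp x (m + n) = siteOp x m + siteOp x n
    simp [siteOp, add_smul, Finset.sum_add_distrib]
  commutes' c := by
    classical
    apply Subtype.ext
    ext f σ
    change siteOp x (algebraMap ℂ _ c) f σ = c • f σ
    rw [siteOp_apply]
    simp [Matrix.algebraMap_matrix_apply]
  map_star' m := by
    apply Subtype.ext
    change siteOp x (star m) = star (siteOp x m)
    simp only [siteOp, star_sum, star_smul, star_unitOp, Matrix.star_apply]
    rw [Finset.sum_comm]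

lemma site_commute {x y : V} (h : x ≠ y) (m : SiteAlg d x) (n : SiteAlg d y) :
    Commute (site x m) (site y n) := by
  classical
  apply Subtype.ext
  ext f σ
  change siteOp x m (siteOp y n f) σ = siteOp y n (siteOp x m f) σ
  simp only [siteOp_apply, Function.update_of_ne h, Function.update_of_ne h.symm, Finset.mul_sum]
  rw [Finset.sum_comm]
  refine Finset.sum_congr rfl fun j _ => Finset.sum_congr rfl fun i _ => ?_
  rw [Function.update_comm h]
  ring

/-- The local algebra `𝒜_Λ ⊆ 𝒜_V`, for an arbitrary set `Λ` of sites. -/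
def loc (Λ : Set V) : StarSubalgebra ℂ (QuasiLocal d) :=
  (StarAlgebra.adjoin ℂ (⋃ x ∈ Λ, Set.range (site (d := d) x))).topologicalClosure

/-! ### Product states and conditional expectations -/

/-- `ω` is the product of the states `φ x`. -/
def IsProductState (φ : ∀ x, SiteAlg d x →ₗ[ℂ] ℂ) (ω : StrongDual ℂ (QuasiLocal d)) : Prop :=
  IsState (ω : QuasiLocal d →ₗ[ℂ] ℂ) ∧
    ∀ (s : Finset V) (m : ∀ x, SiteAlg d x),
      ω (s.noncommProd (fun x => site x (m x)) fun _ _ _ _ h => site_commute h _ _) =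
        ∏ x ∈ s, φ x (m x)

/-- The conditional expectation `𝔼⁰_{{x}ᶜ}`. It is the slice map
`a_x ⊗ b ↦ φ_x(a_x) b`: with the matrix units `e_{kl}` at `x`, every element is of the form
`∑ e_{kl} ⊗ b_{kl}`, where `b_{kl} = ∑ᵢ e_{ik} a e_{li}`. -/
def condSite (φ : ∀ x, SiteAlg d x →ₗ[ℂ] ℂ) (x : V) : QuasiLocal d →L[ℂ] QuasiLocal d :=
  ∑ k, ∑ l, φ x (Matrix.single k l 1) • ∑ i,
    ContinuousLinearMap.mulLeftRight ℂ (QuasiLocal d)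
      (site x (Matrix.single i k 1)) (site x (Matrix.single l i 1))

lemma condSite_apply (φ : ∀ x, SiteAlg d x →ₗ[ℂ] ℂ) (x : V) (a : QuasiLocal d) :
    condSite φ x a = ∑ k, ∑ l, φ x (Matrix.single k l 1) • ∑ i,
      site x (Matrix.single i k 1) * a * site x (Matrix.single l i 1) := by
  simp [condSite]

/-- The defining property `𝔼⁰_{{x}ᶜ}(a_x ⊗ b) = φ_x(a_x) b`. -/
lemma condSite_site_mul (φ : ∀ x, SiteAlg d x →ₗ[ℂ] ℂ) (x : V) (m : SiteAlg d x)
    (b : QuasiLocal d) (hb : ∀ n : SiteAlg d x, Commute (site x n) b) :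
    condSite φ x (site x m * b) = φ x m • b := by
  rw [condSite_apply]
  have key : ∀ k l, ∑ i, site x (Matrix.single i k 1) * (site x m * b) *
      site x (Matrix.single l i 1) = m k l • b := by
    intro k l
    have : ∀ i, site x (Matrix.single i k 1) * (site x m * b) * site x (Matrix.single l i 1) =
        m k l • (site x (Matrix.single i i 1) * b) := by
      intro i
      rw [mul_assoc, mul_assoc, ← (hb _).eq, ← mul_assoc, ← mul_assoc, ← map_mul, ← map_mul,
        Matrix.single_mul_mul_single, ← smul_mul_assoc, ← map_smul]
      simp
    simp only [this, ← Finset.smul_sum, ← Finset.sum_mul, ← map_sum, Matrix.sum_single_one]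
    simp
  simp only [key, smul_smul, ← Finset.sum_smul]
  congr 1
  conv_rhs => rw [Matrix.matrix_eq_sum_single m]
  simp only [map_sum]
  refine Finset.sum_congr rfl fun k _ => Finset.sum_congr rfl fun l _ => ?_
  have : Matrix.single k l (m k l) = m k l • Matrix.single k l (1 : ℂ) := by simp
  rw [this, map_smul, smul_eq_mul, mul_comm]

lemma commute_smul_smul {S T : QuasiLocal d →L[ℂ] QuasiLocal d} (h : Commute S T) (c e : ℂ) :
    Commute (c • S) (e • T) := by
  ext1 a
  have := congrArg (fun R : QuasiLocal d →L[ℂ] QuasiLocal d => R a) h.eq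
  simp only [ContinuousLinearMap.mul_def, ContinuousLinearMap.comp_apply] at this
  simp [ContinuousLinearMap.mul_def, this, smul_smul, mul_comm]

lemma condSite_commute (φ : ∀ x, SiteAlg d x →ₗ[ℂ] ℂ) (x y : V) :
    Commute (condSite φ x) (condSite φ y) := by
  rcases eq_or_ne x y with rfl | h
  · exact Commute.refl _
  · refine Commute.sum_left _ _ _ fun k _ => Commute.sum_left _ _ _ fun l _ =>
      Commute.sum_right _ _ _ fun k' _ => Commute.sum_right _ _ _ fun l' _ =>
      commute_smul_smul (Commute.sum_left _ _ _ fun i _ =>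
        Commute.sum_right _ _ _ fun i' _ => ?_) _ _
    ext1 a
    simp only [ContinuousLinearMap.mul_def, ContinuousLinearMap.comp_apply,
      ContinuousLinearMap.mulLeftRight_apply]
    have h1 := (site_commute h (Matrix.single i k (1 : ℂ)) (Matrix.single i' k' (1 : ℂ))).eq
    have h2 := (site_commute h (Matrix.single l i (1 : ℂ)) (Matrix.single l' i' (1 : ℂ))).eq
    calc _ = (site x (Matrix.single i k (1 : ℂ)) * site y (Matrix.single i' k' (1 : ℂ))) * a *
            (site y (Matrix.single l' i' (1 : ℂ)) * site x (Matrix.single l i (1 : ℂ))) := by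
          simp only [mul_assoc]
      _ = _ := by rw [h1, ← h2]; simp only [mul_assoc]

/-- The conditional expectation `𝔼⁰_{Λᶜ} = ∏_{x ∈ Λ} 𝔼⁰_{{x}ᶜ}` for a finite set `Λ`, which
integrates out the sites in `Λ` (the product is composition). -/
def condExp (φ : ∀ x, SiteAlg d x →ₗ[ℂ] ℂ) (Λ : Finset V) : QuasiLocal d →L[ℂ] QuasiLocal d :=
  Λ.noncommProd (condSite φ) fun x _ y _ _ => condSite_commute φ x y

/-- A quasi-conditional expectation with respect to a triplet `C ⊆ B ⊆ A` of subalgebras of `𝒜_V`: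
a completely positive unital map from `A` to `B` which is `C`-linear on the left. The map is given
as the restriction to `A` of a map on `𝒜_V`. -/
structure IsQuasiCondExp (C B A : StarSubalgebra ℂ (QuasiLocal d))
    (E : QuasiLocal d →L[ℂ] QuasiLocal d) : Prop where
  left_le : C ≤ B
  right_le : B ≤ A
  mem : ∀ a ∈ A, E a ∈ B
  map_one : E 1 = 1
  completelyPositive : ∀ (k : ℕ) (M : CStarMatrix (Fin k) (Fin k) (QuasiLocal d)),
    (∀ i j, M i j ∈ A) → 0 ≤ M → 0 ≤ M.map E
  map_mul : ∀ c ∈ C, ∀ a ∈ A, E (c * a) = c * E a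

/-- The functionals `ψ ∘ E₀ ∘ E₁ ∘ ⋯ ∘ Eₙ`. -/
def backwardComp (ψ : StrongDual ℂ (QuasiLocal d)) (E : ℕ → QuasiLocal d →L[ℂ] QuasiLocal d) :
    ℕ → StrongDual ℂ (QuasiLocal d)
  | 0 => ψ ∘L E 0
  | n + 1 => backwardComp ψ E n ∘L E (n + 1)

/-- Convergence of functionals in the weak-* topology. -/
def WeakStarTendsto {ι : Type*} (l : Filter ι) (ω : ι → StrongDual ℂ (QuasiLocal d))
    (φ : StrongDual ℂ (QuasiLocal d)) : Prop :=
  Filter.Tendsto (fun i => StrongDual.toWeakDual (ω i)) l (𝓝 (StrongDual.toWeakDual φ))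

end Algebra

/-! ### Markov fields and amplitudes -/

section Markov

variable {V : Type u} (G : SimpleGraph V) [G.LocallyFinite] (y₁ : V) {d : V → ℕ}

/-- A backward quantum Markov field with respect to the tessellation `V₀`. The map `E n` is a
quasi-conditional expectation with values in the algebra of the closure of `Λ n`. To make the
compositions meaningful, it has to be defined on the algebra of the closure of `Λ (n + 1)`, where
`E (n + 1)` takes its values, and not only on the algebra of `Λ (n + 1)`; and to have functionals
on all of `𝒜_V`, it is extended to a unital completely positive map on `𝒜_V`. -/
def IsBackwardMarkovField (ω : StrongDual ℂ (QuasiLocal d)) : Prop :=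
  IsState (ω : QuasiLocal d →ₗ[ℂ] ℂ) ∧
    ∀ Λ : ℕ → Finset V, IsAdmissible G y₁ Λ →
      ∃ (ψ : StrongDual ℂ (QuasiLocal d)) (E : ℕ → QuasiLocal d →L[ℂ] QuasiLocal d),
        IsState (ψ : QuasiLocal d →ₗ[ℂ] ℂ) ∧
        (∀ n, IsQuasiCondExp (loc (Λ n)) (loc (closureFin G (Λ n)))
          (loc (closureFin G (Λ (n + 1)))) (E n)) ∧
        (∀ n, IsQuasiCondExp (loc (Λ n)) ⊤ ⊤ (E n)) ∧
        WeakStarTendsto Filter.atTop (backwardComp ψ E) ω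

variable (φ : ∀ x, SiteAlg d x →ₗ[ℂ] ℂ) (K : V → V → QuasiLocal d)

/-- The C⋆-algebra `𝒦` generated by the operators `K y x`, for `y ∈ V₀` and `x ∈ N_y`. -/
def amplitudeAlgebra : StarSubalgebra ℂ (QuasiLocal d) :=
  (StarAlgebra.adjoin ℂ
    {a | ∃ y ∈ tessellation G y₁, ∃ x, G.Adj y x ∧ a = K y x}).topologicalClosure

/-- The product of the operators `K y x` over `x ∈ N_y`. -/
def starProd (y : V) : QuasiLocal d := commProd (G.neighborFinset y) (K y)

/-- The normalization `B_{N_y} = 𝔼⁰_{{y}ᶜ}(|∏_{x ∈ N_y} K y x|²)`. -/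
def normalizer (y : V) : QuasiLocal d :=
  condSite φ y (star (starProd G K y) * starProd G K y)

/-- The plaquette amplitude `(∏_{x ∈ N_y} K y x) B_{N_y}^{-1/2}`. -/
def plaquetteAmplitude (y : V) : QuasiLocal d :=
  starProd G K y * cfc (fun t : ℝ => t ^ (-(1 / 2) : ℝ)) (normalizer G φ K y)

open Classical in
/-- The amplitude attached to `Λ`: the product of the plaquette amplitudes at the points of
`Λ ∩ V₀`. -/
def amplitude (Λ : Finset V) : QuasiLocal d :=
  commProd (Λ.filter (· ∈ tessellation G y₁)) (plaquetteAmplitude G φ K)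

/-- The functional `a ↦ ω(K_Λ⋆ a K_Λ)`. -/
def perturbed (ω : StrongDual ℂ (QuasiLocal d)) (Λ : Finset V) : StrongDual ℂ (QuasiLocal d) :=
  ω ∘L ContinuousLinearMap.mulLeftRight ℂ (QuasiLocal d)
    (star (amplitude G y₁ φ K Λ)) (amplitude G y₁ φ K Λ)

open Classical in
/-- The map `a ↦ 𝔼⁰_{Sᶜ}(K_S⋆ a K_S)` with `S = Λ₂ \ Λ̄₁`. -/
def transition (Λ₁ Λ₂ : Finset V) : QuasiLocal d →L[ℂ] QuasiLocal d :=
  condExp φ (Λ₂ \ closureFin G Λ₁) ∘L ContinuousLinearMap.mulLeftRight ℂ (QuasiLocal d)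
    (star (amplitude G y₁ φ K (Λ₂ \ closureFin G Λ₁))) (amplitude G y₁ φ K (Λ₂ \ closureFin G Λ₁))

open Classical in
/-- The map `a ↦ 𝔼⁰_{Tᶜ}(K_S⋆ a K_S)` with `S = Λ₂ \ Λ̄₁` and `T = Λ̄₂ \ Λ̄₁`: since `K_S` may
involve sites in the external boundary of `Λ₂`, these have to be integrated out as well in order to
obtain values in the algebra of `Λ̄₁`. -/
def localTransition (Λ₁ Λ₂ : Finset V) : QuasiLocal d →L[ℂ] QuasiLocal d :=
  condExp φ (closureFin G Λ₂ \ closureFin G Λ₁) ∘L ContinuousLinearMap.mulLeftRight ℂ (QuasiLocal d)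
    (star (amplitude G y₁ φ K (Λ₂ \ closureFin G Λ₁))) (amplitude G y₁ φ K (Λ₂ \ closureFin G Λ₁))

end Markov

end QuantumMarkov

end

/-!
Everything rests on one identity. Let `K_y` be the plaquette amplitude at a point `y ∈ V₀`. The
normalization `B_{N_y}` does not involve the site `y` and is bounded below because the product of
the `K y x` is invertible, so that the slice map `𝔼⁰_{{y}ᶜ}` is linear over `B_{N_y}^{-1/2}` and
`𝔼⁰_{{y}ᶜ}(K_y⋆ K_y) = 1` (`IsAmplitudeSystem.condSite_star_mul_self`). The amplitudes commute:
only the commutation of `B_{N_y}` with `B_{N_z}` needs an argument, and it follows since `B_{N_z}`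
passes through `𝔼⁰_{{y}ᶜ}` and commutes with `𝒦` (`IsAmplitudeSystem.commute_normalizer`).

No other amplitude touches the site `y`. Hence a functional, or map, that is invariant under
`𝔼⁰_{{y}ᶜ}` does not see `K_y` in `K_Λ⋆ a K_Λ` as long as `a` lives off the plaquette of `y`
(`IsAmplitudeSystem.apply_conj_amplitude_sdiff`). Applied to the product state, this
shows that the perturbed functionals are states and that they stabilize on local elements; since
states are contractive and the local elements are dense, the net converges
(`exists_weakStarTendsto`). Applied to the conditional expectations, it shows that the transition
maps are unital. They are completely positive because a state on a matrix algebra has a positive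
semidefinite density matrix, which gives its slice map a Kraus form (`condSite_eq_sum_conj`).

The boundary of `Λₙ` does not meet `V₀`, so `Λₙ₊₁` and `Sₙ ∪ Λₙ` contain the same points of `V₀`,
and composing the perturbed state of `Λₙ` with the `n`-th transition map gives exactly the
perturbed state of `Λₙ₊₁` (`IsAmplitudeSystem.perturbed_transition`). The backward compositions
are therefore a subsequence of the convergent net, as the `Λₙ` exhaust the graph.

The product state itself is obtained by the same limit theorem from the functionals that integrate
out finitely many sites and then apply a vector state of `ℓ²(Ω)`.
-/

noncomputable section

namespace QuantumMarkov

universe u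

/-! ### Local algebras and slice maps -/

section Local

variable {V : Type u} {d : V → ℕ}

lemma isClosed_loc (Λ : Set V) : IsClosed (loc (d := d) Λ : Set (QuasiLocal d)) :=
  StarSubalgebra.isClosed_topologicalClosure _

lemma loc_mono {Λ Γ : Set V} (h : Λ ⊆ Γ) : loc (d := d) Λ ≤ loc Γ :=
  StarSubalgebra.topologicalClosure_mono
    (StarAlgebra.adjoin_mono (Set.biUnion_subset_biUnion_left h))

lemma site_mem_loc {Λ : Set V} {x : V} (hx : x ∈ Λ) (m : SiteAlg d x) : site x m ∈ loc Λ :=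
  StarSubalgebra.le_topologicalClosure _
    (StarAlgebra.subset_adjoin ℂ _ (Set.mem_biUnion hx ⟨m, rfl⟩))

lemma loc_le_of_site_mem {Λ : Set V} {S : StarSubalgebra ℂ (QuasiLocal d)}
    (hS : IsClosed (S : Set (QuasiLocal d))) (h : ∀ x ∈ Λ, ∀ m, site x m ∈ S) : loc Λ ≤ S := by
  refine StarSubalgebra.topologicalClosure_minimal (StarAlgebra.adjoin_le ?_) hS
  simp only [Set.iUnion_subset_iff]
  rintro x hx _ ⟨m, rfl⟩
  exact h x hx m

lemma isClosed_centralizer (s : Set (QuasiLocal d)) :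
    IsClosed (StarSubalgebra.centralizer ℂ s : Set (QuasiLocal d)) := by
  rw [StarSubalgebra.coe_centralizer]
  exact Set.isClosed_centralizer _

/-- Sites outside `Λ` commute with the local algebra of `Λ`. -/
lemma commute_site_of_mem_loc {Λ : Set V} {x : V} (hx : x ∉ Λ) (n : SiteAlg d x)
    {a : QuasiLocal d} (ha : a ∈ loc Λ) : Commute (site x n) a := by
  have h : loc (d := d) Λ ≤ StarSubalgebra.centralizer ℂ (Set.range (site (d := d) x)) := by
    refine loc_le_of_site_mem (isClosed_centralizer _) fun y hy m => ?_
    rw [StarSubalgebra.mem_centralizer_iff]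
    rintro _ ⟨k, rfl⟩
    have hxy : x ≠ y := fun e => hx (e ▸ hy)
    rw [← map_star]
    exact ⟨site_commute hxy _ _, site_commute hxy _ _⟩
  exact ((StarSubalgebra.mem_centralizer_iff ℂ).1 (h ha) _ ⟨n, rfl⟩).1

lemma commute_of_mem_loc {Λ Γ : Set V} (h : Disjoint Λ Γ) {a b : QuasiLocal d}
    (ha : a ∈ loc Λ) (hb : b ∈ loc Γ) : Commute a b := by
  have h' : loc (d := d) Λ ≤ StarSubalgebra.centralizer ℂ (loc (d := d) Γ : Set _) := by
    refine loc_le_of_site_mem (isClosed_centralizer _) fun x hx m => ?_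
    rw [StarSubalgebra.mem_centralizer_iff]
    intro c hc
    have hx' : x ∉ Γ := Set.disjoint_left.1 h hx
    exact ⟨(commute_site_of_mem_loc hx' m hc).eq.symm,
      (commute_site_of_mem_loc hx' m (star_mem hc)).eq.symm⟩
  exact (((StarSubalgebra.mem_centralizer_iff ℂ).1 (h' ha) _ hb).1).symm

/-- The coefficient `b_{kl}` in the expansion `a = ∑ e_{kl} ⊗ b_{kl}` over the matrix units at the
site `x`. -/
def coeff (x : V) (k l : Fin (d x)) : QuasiLocal d →L[ℂ] QuasiLocal d :=
  ∑ i, ContinuousLinearMap.mulLeftRight ℂ (QuasiLocal d)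
      (site x (Matrix.single i k 1)) (site x (Matrix.single l i 1))

lemma coeff_apply (x : V) (k l : Fin (d x)) (a : QuasiLocal d) :
    coeff x k l a = ∑ i, site x (Matrix.single i k 1) * a * site x (Matrix.single l i 1) := by
  simp [coeff]

lemma condSite_eq_sum_coeff (φ : ∀ x, SiteAlg d x →ₗ[ℂ] ℂ) (x : V) (a : QuasiLocal d) :
    condSite φ x a = ∑ k, ∑ l, φ x (Matrix.single k l 1) • coeff x k l a := by
  simp only [condSite_apply, coeff_apply]

lemma coeff_site_mul (x : V) (k l : Fin (d x)) (m : SiteAlg d x) {b : QuasiLocal d}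
    (hb : ∀ n : SiteAlg d x, Commute (site x n) b) : coeff x k l (site x m * b) = m k l • b := by
  rw [coeff_apply]
  have key (i : Fin (d x)) : site x (Matrix.single i k 1) * (site x m * b) *
      site x (Matrix.single l i 1) = m k l • (site x (Matrix.single i i 1) * b) := by
    rw [mul_assoc, mul_assoc, ← (hb _).eq, ← mul_assoc, ← mul_assoc, ← map_mul, ← map_mul,
      Matrix.single_mul_mul_single, ← smul_mul_assoc, ← map_smul]
    simp
  simp only [key, ← Finset.smul_sum, ← Finset.sum_mul, ← map_sum, Matrix.sum_single_one]
  simp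

lemma coeff_of_commute (x : V) (k l : Fin (d x)) {b : QuasiLocal d}
    (hb : ∀ n : SiteAlg d x, Commute (site x n) b) :
    coeff x k l b = (1 : SiteAlg d x) k l • b := by
  simpa using coeff_site_mul x k l 1 hb

/-- The coefficients multiply like matrices. -/
lemma coeff_mul (x : V) (k l : Fin (d x)) (a b : QuasiLocal d) :
    coeff x k l (a * b) = ∑ m, coeff x k m a * coeff x m l b := by
  have h1 : (1 : QuasiLocal d) = ∑ m, site x (Matrix.single m m (1 : ℂ)) := by
    rw [← map_sum, Matrix.sum_single_one, map_one]
  have h2 (m i j : Fin (d x)) : site x (Matrix.single m i (1 : ℂ)) *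
      site x (Matrix.single j m (1 : ℂ)) =
        if i = j then site x (Matrix.single m m (1 : ℂ)) else 0 := by
    rw [← map_mul]
    split_ifs with h
    · subst h; simp
    · simp [Matrix.single_mul_single_of_ne _ _ _ _ h]
  have key (m i j : Fin (d x)) :
      site x (Matrix.single i k (1 : ℂ)) * a * site x (Matrix.single m i (1 : ℂ)) *
        (site x (Matrix.single j m (1 : ℂ)) * b * site x (Matrix.single l j (1 : ℂ))) =
      if i = j then site x (Matrix.single i k (1 : ℂ)) * a * site x (Matrix.single m m (1 : ℂ)) *
        b * site x (Matrix.single l i (1 : ℂ)) else 0 := by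
    have : site x (Matrix.single m i (1 : ℂ)) * site x (Matrix.single j m (1 : ℂ)) =
        if i = j then site x (Matrix.single m m (1 : ℂ)) else 0 := h2 m i j
    calc _ = site x (Matrix.single i k (1 : ℂ)) * a * (site x (Matrix.single m i (1 : ℂ)) *
            site x (Matrix.single j m (1 : ℂ))) * b * site x (Matrix.single l j (1 : ℂ)) := by
          simp only [mul_assoc]
      _ = _ := by
          rw [this]
          split_ifs with h
          · subst h; rfl
          · simp
  simp only [coeff_apply, Finset.sum_mul, Finset.mul_sum, key]
  simp only [Finset.sum_ite_eq', Finset.mem_univ, if_true]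
  rw [Finset.sum_comm]
  refine Finset.sum_congr rfl fun i _ => ?_
  rw [← Finset.sum_mul, ← Finset.sum_mul, ← Finset.mul_sum, ← h1, mul_one, mul_assoc _ a b]

lemma coeff_star (x : V) (k l : Fin (d x)) (a : QuasiLocal d) :
    coeff x k l (star a) = star (coeff x l k a) := by
  have h (i j : Fin (d x)) : star (site x (Matrix.single i j (1 : ℂ))) =
      site x (Matrix.single j i (1 : ℂ)) := by
    rw [← map_star, Matrix.star_eq_conjTranspose, Matrix.conjTranspose_single, star_one]
  simp only [coeff_apply, star_sum, star_mul, h, mul_assoc]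

lemma commute_site_coeff (x : V) (k l : Fin (d x)) (n : SiteAlg d x) (a : QuasiLocal d) :
    Commute (site x n) (coeff x k l a) := by
  rw [Matrix.matrix_eq_sum_single n]
  simp only [map_sum]
  refine Commute.sum_left _ _ _ fun p _ => Commute.sum_left _ _ _ fun q _ => ?_
  have : Matrix.single p q (n p q) = n p q • Matrix.single p q (1 : ℂ) := by simp
  rw [this, map_smul]
  refine Commute.smul_left ?_ _
  rw [Commute, SemiconjBy, coeff_apply, Finset.mul_sum, Finset.sum_mul,
    Finset.sum_eq_single q, Finset.sum_eq_single p]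
  · rw [← mul_assoc, ← mul_assoc, ← map_mul, mul_assoc _ _ (site x (Matrix.single p q (1 : ℂ))),
      ← map_mul]
    simp
  · intro i _ hi
    rw [mul_assoc, ← map_mul, Matrix.single_mul_single_of_ne _ _ _ _ hi]
    simp
  · simp
  · intro i _ hi
    rw [← mul_assoc, ← mul_assoc, ← map_mul, Matrix.single_mul_single_of_ne _ _ _ _ hi.symm]
    simp
  · simp

/-- The coefficients at `x` of an element of `𝒜_Λ` no longer involve the site `x`: the elements with
this property form a closed star subalgebra that contains the generators. -/
lemma coeff_mem_loc {Λ : Set V} (x : V) (k l : Fin (d x)) {a : QuasiLocal d} (ha : a ∈ loc Λ) :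
    coeff x k l a ∈ loc (Λ \ {x}) := by
  let S : StarSubalgebra ℂ (QuasiLocal d) :=
    { carrier := {a | ∀ k l, coeff x k l a ∈ loc (d := d) (Λ \ {x})}
      mul_mem' := fun {a b} ha hb k l => by
        rw [coeff_mul]
        exact sum_mem fun m _ => mul_mem (ha _ _) (hb _ _)
      add_mem' := fun {a b} ha hb k l => by
        rw [map_add]
        exact add_mem (ha _ _) (hb _ _)
      algebraMap_mem' := fun r k l => by
        rw [coeff_of_commute x k l fun n => Algebra.commutes' r _ |>.symm]
        exact SMulMemClass.smul_mem _ (algebraMap_mem _ r)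
      star_mem' := fun {a} ha k l => by
        rw [coeff_star]
        exact star_mem (ha _ _) }
  have hS : IsClosed (S : Set (QuasiLocal d)) := by
    have : (S : Set (QuasiLocal d)) =
        ⋂ k, ⋂ l, coeff x k l ⁻¹' (loc (d := d) (Λ \ {x}) : Set (QuasiLocal d)) := by
      ext a
      simp only [Set.mem_iInter]
      rfl
    rw [this]
    exact isClosed_iInter fun k => isClosed_iInter fun l =>
      (isClosed_loc _).preimage (coeff x k l).continuous
  refine loc_le_of_site_mem (S := S) hS (fun y hy m k l => ?_) ha k l
  rcases eq_or_ne y x with rfl | hne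
  · have := coeff_site_mul y k l m (b := 1) fun n => Commute.one_right _
    rw [mul_one] at this
    rw [this]
    exact SMulMemClass.smul_mem _ (one_mem _)
  · rw [coeff_of_commute x k l fun n => site_commute hne.symm _ _]
    exact SMulMemClass.smul_mem _ (site_mem_loc (Set.mem_sdiff_singleton.2 ⟨hy, hne⟩) m)

lemma coeff_mul_mul (x : V) (k l : Fin (d x)) {b c : QuasiLocal d}
    (hb : ∀ n : SiteAlg d x, Commute (site x n) b) (hc : ∀ n : SiteAlg d x, Commute (site x n) c)
    (a : QuasiLocal d) : coeff x k l (b * a * c) = b * coeff x k l a * c := by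
  simp only [coeff_apply, Finset.mul_sum, Finset.sum_mul]
  refine Finset.sum_congr rfl fun i _ => ?_
  calc _ = (site x (Matrix.single i k (1 : ℂ)) * b) * a *
        (c * site x (Matrix.single l i (1 : ℂ))) := by simp only [mul_assoc]
    _ = _ := by rw [(hb _).eq, ← (hc _).eq]; simp only [mul_assoc]

/-! ### Conditional expectations -/

variable (φ : ∀ x, SiteAlg d x →ₗ[ℂ] ℂ)

lemma condSite_mem_loc {Λ : Set V} (x : V) {a : QuasiLocal d} (ha : a ∈ loc Λ) :
    condSite φ x a ∈ loc (Λ \ {x}) := by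
  rw [condSite_eq_sum_coeff]
  exact sum_mem fun k _ => sum_mem fun l _ => SMulMemClass.smul_mem _ (coeff_mem_loc x k l ha)

lemma condSite_mul_mul (x : V) {b c : QuasiLocal d}
    (hb : ∀ n : SiteAlg d x, Commute (site x n) b) (hc : ∀ n : SiteAlg d x, Commute (site x n) c)
    (a : QuasiLocal d) : condSite φ x (b * a * c) = b * condSite φ x a * c := by
  simp only [condSite_eq_sum_coeff, coeff_mul_mul x _ _ hb hc, Finset.mul_sum, Finset.sum_mul,
    mul_smul_comm, smul_mul_assoc]

lemma commute_site_condSite (x : V) (n : SiteAlg d x) (a : QuasiLocal d) :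
    Commute (site x n) (condSite φ x a) := by
  rw [condSite_eq_sum_coeff]
  exact Commute.sum_right _ _ _ fun k _ => Commute.sum_right _ _ _ fun l _ =>
    (commute_site_coeff x k l n a).smul_right _

variable {φ}

lemma condSite_of_commute (hφ : ∀ x, IsState (φ x)) (x : V) {b : QuasiLocal d}
    (hb : ∀ n : SiteAlg d x, Commute (site x n) b) : condSite φ x b = b := by
  have := condSite_site_mul φ x 1 b hb
  rwa [map_one, one_mul, (hφ x).1, one_smul] at this

lemma condSite_condSite (hφ : ∀ x, IsState (φ x)) (x : V) (a : QuasiLocal d) :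
    condSite φ x (condSite φ x a) = condSite φ x a :=
  condSite_of_commute hφ x fun n => commute_site_condSite φ x n a

variable (φ)

lemma condExp_empty (a : QuasiLocal d) : condExp φ ∅ a = a := rfl

open Classical in
lemma condExp_insert {Λ : Finset V} {x : V} (hx : x ∉ Λ) (a : QuasiLocal d) :
    condExp φ (insert x Λ) a = condSite φ x (condExp φ Λ a) := by
  exact DFunLike.congr_fun (Finset.noncommProd_insert_of_notMem Λ x (condSite φ)
    (fun x _ y _ _ => condSite_commute φ x y) hx) a

open Classical in
lemma condExp_insert' {Λ : Finset V} {x : V} (hx : x ∉ Λ) (a : QuasiLocal d) :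
    condExp φ (insert x Λ) a = condExp φ Λ (condSite φ x a) := by
  exact DFunLike.congr_fun (Finset.noncommProd_insert_of_notMem' Λ x (condSite φ)
    (fun x _ y _ _ => condSite_commute φ x y) hx) a

variable {φ} in
/-- A conditional expectation absorbs the integration over each of its sites. -/
lemma condExp_condSite (hφ : ∀ x, IsState (φ x)) {Λ : Finset V} {x : V} (hx : x ∈ Λ)
    (a : QuasiLocal d) : condExp φ Λ (condSite φ x a) = condExp φ Λ a := by
  classical
  rw [← Finset.insert_erase hx, condExp_insert' φ (Finset.notMem_erase x Λ),
    condExp_insert' φ (Finset.notMem_erase x Λ), condSite_condSite hφ]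

lemma condExp_mem_loc {Γ : Set V} (Λ : Finset V) {a : QuasiLocal d} (ha : a ∈ loc Γ) :
    condExp φ Λ a ∈ loc (Γ \ Λ) := by
  classical
  induction Λ using Finset.induction_on with
  | empty => simpa [condExp_empty] using ha
  | insert x s hx ih =>
    rw [condExp_insert φ hx]
    refine loc_mono ?_ (condSite_mem_loc φ x ih)
    rintro y ⟨⟨h1, h2⟩, h3⟩
    refine ⟨h1, ?_⟩
    simp only [Finset.coe_insert, Set.mem_insert_iff, not_or]
    exact ⟨h3, h2⟩

lemma condExp_mul_mul {Γ : Set V} {Λ : Finset V} (h : Disjoint Γ (Λ : Set V)) {b c : QuasiLocal d}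
    (hb : b ∈ loc Γ) (hc : c ∈ loc Γ) (a : QuasiLocal d) :
    condExp φ Λ (b * a * c) = b * condExp φ Λ a * c := by
  classical
  induction Λ using Finset.induction_on with
  | empty => simp [condExp_empty]
  | insert x s hx ih =>
    simp only [Finset.coe_insert, Set.disjoint_insert_right] at h
    rw [condExp_insert φ hx, condExp_insert φ hx, ih h.2,
      condSite_mul_mul φ x (fun n => commute_site_of_mem_loc h.1 n hb)
        (fun n => commute_site_of_mem_loc h.1 n hc)]

/-- A map invariant under the integration over each site of `Λ` is invariant under `𝔼⁰_{Λᶜ}`. -/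
lemma apply_condExp {X : Type*} (F : QuasiLocal d → X) (Λ : Finset V)
    (hF : ∀ x ∈ Λ, ∀ a, F (condSite φ x a) = F a) (a : QuasiLocal d) :
    F (condExp φ Λ a) = F a := by
  classical
  induction Λ using Finset.induction_on with
  | empty => rfl
  | insert x s hx ih =>
    rw [condExp_insert φ hx, hF x (Finset.mem_insert_self x s),
      ih fun y hy => hF y (Finset.mem_insert_of_mem hy)]

variable {φ}

lemma condExp_one (hφ : ∀ x, IsState (φ x)) (Λ : Finset V) : condExp φ Λ 1 = 1 := by
  classical
  induction Λ using Finset.induction_on with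
  | empty => rfl
  | insert x s hx ih =>
    rw [condExp_insert φ hx, ih, condSite_of_commute hφ x fun n => Commute.one_right _]

end Local

/-! ### States -/

section States

lemma IsState.map_star {A : Type*} [Ring A] [StarRing A] [Algebra ℂ A] [StarModule ℂ A]
    {ω : A →ₗ[ℂ] ℂ} (h : IsState ω) (a : A) : ω (star a) = star (ω a) := by
  -- the values at `a⋆a`, `(a + 1)⋆(a + 1)` and `(a + i)⋆(a + i)` are all real
  have h0 := (Complex.nonneg_iff.1 (h.2 a)).2
  have h1 := (Complex.nonneg_iff.1 (h.2 (a + 1))).2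
  have h2 := (Complex.nonneg_iff.1 (h.2 (a + Complex.I • 1))).2
  simp only [star_add, star_one, star_smul, add_mul, mul_add, mul_one, one_mul, map_add, h.1,
    smul_mul_assoc, mul_smul_comm, map_smul, smul_eq_mul] at h1 h2
  apply Complex.ext
  · simp at h1 h2 ⊢
    linarith
  · simp at h1 h2 ⊢
    linarith

variable {V : Type u} {d : V → ℕ}

lemma IsState.nonneg {ω : QuasiLocal d →ₗ[ℂ] ℂ} (h : IsState ω) {a : QuasiLocal d} (ha : 0 ≤ a) :
    0 ≤ ω a := by
  obtain ⟨b, rfl⟩ := CStarAlgebra.nonneg_iff_eq_star_mul_self.1 ha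
  exact h.2 b

/-- States are contractive, by the Cauchy–Schwarz inequality. -/
lemma IsState.norm_le {ω : QuasiLocal d →ₗ[ℂ] ℂ} (h : IsState ω) (a : QuasiLocal d) :
    ‖ω a‖ ≤ ‖a‖ := by
  have h1 : ω (star a * a) ≤ ((‖a‖ ^ 2 : ℝ) : ℂ) := by
    have := h.nonneg (sub_nonneg.2 (CStarAlgebra.star_mul_le_algebraMap_norm_sq (a := a)))
    rw [map_sub, Algebra.algebraMap_eq_smul_one, ← Complex.coe_smul, map_smul, h.1, smul_eq_mul,
      mul_one] at this
    exact sub_nonneg.1 this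
  -- the variance of `a` is nonnegative
  have h2 := h.2 (a - ω a • 1)
  simp only [star_sub, star_one, star_smul, sub_mul, mul_sub, mul_one, one_mul, map_sub, h.1,
    smul_mul_assoc, mul_smul_comm, map_smul, smul_eq_mul, h.map_star] at h2
  have h3 : ((‖ω a‖ ^ 2 : ℝ) : ℂ) = star (ω a) * ω a := by
    rw [Complex.star_def, Complex.conj_mul']
    norm_cast
  have h4 : ((‖ω a‖ ^ 2 : ℝ) : ℂ) ≤ ((‖a‖ ^ 2 : ℝ) : ℂ) := by
    refine le_trans ?_ h1
    rw [h3, ← sub_nonneg]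
    convert h2 using 1
    ring
  exact (sq_le_sq₀ (norm_nonneg _) (norm_nonneg _)).1 (Complex.real_le_real.1 h4)

/-! ### Complete positivity -/

/-- Complete positivity of a map on the quasi-local algebra. -/
def IsCompletelyPositive (E : QuasiLocal d → QuasiLocal d) : Prop :=
  ∀ (k : ℕ) (M : CStarMatrix (Fin k) (Fin k) (QuasiLocal d)), 0 ≤ M → 0 ≤ M.map E

lemma IsCompletelyPositive.comp {E F : QuasiLocal d → QuasiLocal d} (hE : IsCompletelyPositive E)
    (hF : IsCompletelyPositive F) : IsCompletelyPositive (fun a => E (F a)) :=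
  fun k M hM => hE k _ (hF k M hM)

lemma isCompletelyPositive_sum {ι : Type*} (s : Finset ι) (E : ι → QuasiLocal d → QuasiLocal d)
    (hE : ∀ i ∈ s, IsCompletelyPositive (E i)) :
    IsCompletelyPositive (fun a => ∑ i ∈ s, E i a) := by
  intro k M hM
  have : M.map (fun a => ∑ i ∈ s, E i a) = ∑ i ∈ s, M.map (E i) := by
    ext p q
    classical
    induction s using Finset.induction_on with
    | empty => rfl
    | insert x s hx ih =>
      rw [Finset.sum_insert hx, CStarMatrix.add_apply,
        ← ih fun i hi => hE i (Finset.mem_insert_of_mem hi), CStarMatrix.map_apply,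
        CStarMatrix.map_apply, CStarMatrix.map_apply, Finset.sum_insert hx]
  rw [this]
  exact Finset.sum_nonneg fun i hi => hE i hi k M hM

lemma isCompletelyPositive_conj (b : QuasiLocal d) :
    IsCompletelyPositive (fun a => star b * a * b) := by
  intro k M hM
  let D : CStarMatrix (Fin k) (Fin k) (QuasiLocal d) :=
    CStarMatrix.ofMatrix (Matrix.diagonal fun _ => b)
  have : M.map (fun a => star b * a * b) = star D * M * D := by
    ext p q
    simp [D, CStarMatrix.mul_apply, CStarMatrix.star_apply, Matrix.diagonal_apply,
      CStarMatrix.map_apply, apply_ite star]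
  rw [this]
  exact star_left_conjugate_nonneg hM D

open scoped MatrixOrder in
/-- The density matrix of a state is positive semidefinite, hence factors. -/
lemma IsState.exists_factor {n : ℕ} {f : Matrix (Fin n) (Fin n) ℂ →ₗ[ℂ] ℂ} (hf : IsState f) :
    ∃ C : Matrix (Fin n) (Fin n) ℂ,
      ∀ k l, f (Matrix.single k l 1) = ∑ m, star (C m k) * C m l := by
  let R : Matrix (Fin n) (Fin n) ℂ := Matrix.of fun k l => f (Matrix.single k l 1)
  have hRv (k l : Fin n) : R k l = f (Matrix.single k l 1) := rfl
  have hR : R.PosSemidef := by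
    refine Matrix.PosSemidef.of_dotProduct_mulVec_nonneg ?_ fun v => ?_
    · ext k l
      rw [Matrix.conjTranspose_apply, hRv, hRv, ← hf.map_star,
        Matrix.star_eq_conjTranspose, Matrix.conjTranspose_single, star_one]
    · rcases isEmpty_or_nonempty (Fin n) with hn | ⟨⟨i⟩⟩
      · simp
      -- the quadratic form at `v` is the value of the state at `w⋆w` with `w = ∑ vₗ e_{il}`
      · have := hf.2 (∑ l, v l • Matrix.single i l (1 : ℂ))
        convert this using 1
        simp only [dotProduct, Matrix.mulVec, hRv, star_sum, star_smul,
          Matrix.star_eq_conjTranspose, Matrix.conjTranspose_single, star_one, Finset.sum_mul,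
          Finset.mul_sum, smul_mul_assoc, mul_smul_comm, map_sum, map_smul, smul_eq_mul,
          Matrix.single_mul_single_same, mul_one, Pi.star_apply]
        rw [Finset.sum_comm]
        refine Finset.sum_congr rfl fun k _ => Finset.sum_congr rfl fun l _ => ?_
        ring
  obtain ⟨C, hC⟩ := CStarAlgebra.nonneg_iff_eq_star_mul_self.1 hR.nonneg
  refine ⟨C, fun k l => ?_⟩
  have := congrFun (congrFun hC k) l
  simpa [R, Matrix.mul_apply] using this

/-- The Kraus form of the conditional expectation at a site. -/
lemma condSite_eq_sum_conj {φ : ∀ x, SiteAlg d x →ₗ[ℂ] ℂ} (hφ : ∀ x, IsState (φ x)) (x : V) :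
    ∃ A : Fin (d x) × Fin (d x) → QuasiLocal d,
      ∀ a, condSite φ x a = ∑ p, star (A p) * a * A p := by
  obtain ⟨C, hC⟩ := (hφ x).exists_factor
  refine ⟨fun p => site x (∑ l, C p.1 l • Matrix.single l p.2 1), fun a => ?_⟩
  have h (p : Fin (d x) × Fin (d x)) : star (site x (∑ l, C p.1 l • Matrix.single l p.2 (1 : ℂ))) =
      ∑ k, star (C p.1 k) • site x (Matrix.single p.2 k 1) := by
    rw [← map_star]
    simp only [star_sum, star_smul, Matrix.star_eq_conjTranspose, Matrix.conjTranspose_single,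
      star_one, map_sum, map_smul]
  simp only [condSite_apply, h, hC, Fintype.sum_prod_type]
  simp only [map_sum, map_smul, Finset.sum_mul, Finset.mul_sum, smul_mul_assoc, mul_smul_comm,
    Finset.sum_smul, Finset.smul_sum, smul_smul]
  refine ((Finset.sum_congr rfl fun k _ => (Finset.sum_congr rfl fun l _ =>
    Finset.sum_comm).trans Finset.sum_comm).trans Finset.sum_comm).trans ?_
  refine Finset.sum_congr rfl fun m _ => ((Finset.sum_congr rfl fun k _ =>
    Finset.sum_comm).trans Finset.sum_comm).trans ?_
  refine Finset.sum_congr rfl fun i _ => Finset.sum_comm.trans ?_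
  refine Finset.sum_congr rfl fun l _ => Finset.sum_congr rfl fun k _ => ?_
  rw [mul_comm]

lemma isCompletelyPositive_condSite {φ : ∀ x, SiteAlg d x →ₗ[ℂ] ℂ} (hφ : ∀ x, IsState (φ x))
    (x : V) : IsCompletelyPositive (condSite φ x) := by
  obtain ⟨A, hA⟩ := condSite_eq_sum_conj hφ x
  rw [show (condSite φ x : QuasiLocal d → QuasiLocal d) = _ from funext hA]
  exact isCompletelyPositive_sum _ _ fun p _ => isCompletelyPositive_conj (A p)

lemma isCompletelyPositive_condExp {φ : ∀ x, SiteAlg d x →ₗ[ℂ] ℂ} (hφ : ∀ x, IsState (φ x))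
    (Λ : Finset V) : IsCompletelyPositive (condExp φ Λ) := by
  classical
  induction Λ using Finset.induction_on with
  | empty => exact fun k M hM => hM
  | insert x s hx ih =>
    rw [show (condExp φ (insert x s) : QuasiLocal d → QuasiLocal d) = _ from
      funext (condExp_insert φ hx)]
    exact (isCompletelyPositive_condSite hφ x).comp ih

lemma condSite_nonneg {φ : ∀ x, SiteAlg d x →ₗ[ℂ] ℂ} (hφ : ∀ x, IsState (φ x)) (x : V)
    {a : QuasiLocal d} (ha : 0 ≤ a) : 0 ≤ condSite φ x a := by
  obtain ⟨A, hA⟩ := condSite_eq_sum_conj hφ x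
  rw [hA]
  exact Finset.sum_nonneg fun p _ => star_left_conjugate_nonneg ha _

lemma condExp_nonneg {φ : ∀ x, SiteAlg d x →ₗ[ℂ] ℂ} (hφ : ∀ x, IsState (φ x)) (Λ : Finset V)
    {a : QuasiLocal d} (ha : 0 ≤ a) : 0 ≤ condExp φ Λ a := by
  classical
  induction Λ using Finset.induction_on with
  | empty => exact ha
  | insert x s hx ih =>
    rw [condExp_insert φ hx]
    exact condSite_nonneg hφ x ih

/-! ### Density of the local elements -/

open Classical in
/-- A product of one-site operators. -/
def siteProd (s : Finset V) (m : ∀ x, SiteAlg d x) : QuasiLocal d :=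
  s.noncommProd (fun x => site x (m x)) fun _ _ _ _ h => site_commute h _ _

open Classical in
lemma siteProd_insert {s : Finset V} {x : V} (hx : x ∉ s) (m : ∀ x, SiteAlg d x) :
    siteProd (insert x s) m = site x (m x) * siteProd s m :=
  Finset.noncommProd_insert_of_notMem s x (fun x => site x (m x))
    (fun _ _ _ _ h => site_commute h _ _) hx

lemma siteProd_congr {s : Finset V} {m n : ∀ x, SiteAlg d x} (h : ∀ x ∈ s, m x = n x) :
    siteProd s m = siteProd s n :=
  Finset.noncommProd_congr rfl (fun x hx => by rw [h x hx]) _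

lemma siteProd_mem_loc (s : Finset V) (m : ∀ x, SiteAlg d x) : siteProd s m ∈ loc (s : Set V) :=
  Finset.noncommProd_induction s _ _ (· ∈ loc (d := d) (s : Set V)) (fun _ _ => mul_mem)
    (one_mem _) fun _ hx => site_mem_loc hx _

variable (d) in
/-- The finite products of one-site operators contain the monoid generated by the sites. -/
lemma exists_eq_siteProd_of_mem_closure {a : QuasiLocal d}
    (ha : a ∈ Submonoid.closure (⋃ x : V, Set.range (site (d := d) x))) :
    ∃ s m, a = siteProd s m := by
  classical
  induction ha using Submonoid.closure_induction_left with
  | one => exact ⟨∅, fun _ => 1, rfl⟩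
  | mul_left b hb c hc ih =>
    obtain ⟨x, n, rfl⟩ := Set.mem_iUnion.1 hb
    obtain ⟨s, m, rfl⟩ := ih
    have hm (y : V) (hy : y ∈ s.erase x) (k : SiteAlg d x) : Function.update m x k y = m y :=
      Function.update_of_ne (Finset.ne_of_mem_erase hy) _ _
    by_cases hx : x ∈ s
    · refine ⟨insert x (s.erase x), Function.update m x (n * m x), ?_⟩
      conv_lhs => rw [← Finset.insert_erase hx]
      rw [siteProd_insert (Finset.notMem_erase x s), siteProd_insert (Finset.notMem_erase x s),
        siteProd_congr fun y hy => hm y hy _, Function.update_self, map_mul, mul_assoc]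
    · refine ⟨insert x s, Function.update m x n, ?_⟩
      rw [siteProd_insert hx, Function.update_self,
        siteProd_congr fun y hy => hm y (Finset.mem_erase.2 ⟨fun e => hx (e ▸ hy), hy⟩) _]

variable (d) in
lemma adjoin_site_le_span :
    (StarAlgebra.adjoin ℂ (⋃ x : V, Set.range (site (d := d) x)) : Set (QuasiLocal d)) ⊆
      Submodule.span ℂ {a | ∃ s m, a = siteProd (d := d) s m} := by
  have hstar : star (⋃ x : V, Set.range (site (d := d) x)) =
      ⋃ x : V, Set.range (site (d := d) x) := by
    ext a
    simp only [Set.mem_star, Set.mem_iUnion, Set.mem_range]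
    constructor
    · rintro ⟨x, m, h⟩
      exact ⟨x, star m, by rw [map_star, h, star_star]⟩
    · rintro ⟨x, m, rfl⟩
      exact ⟨x, star m, by rw [map_star]⟩
  intro a ha
  have : a ∈ Algebra.adjoin ℂ (⋃ x : V, Set.range (site (d := d) x)) := by
    have h2 := StarAlgebra.adjoin_toSubalgebra ℂ (⋃ x : V, Set.range (site (d := d) x))
    rw [hstar, Set.union_self] at h2
    rw [← h2]
    exact ha
  rw [← Subalgebra.mem_toSubmodule, Algebra.adjoin_eq_span] at this
  exact Submodule.span_mono (fun b hb => exists_eq_siteProd_of_mem_closure d hb) this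

variable (d) in
lemma dense_adjoin_site :
    Dense (StarAlgebra.adjoin ℂ (⋃ x : V, Set.range (site (d := d) x)) : Set (QuasiLocal d)) := by
  have hmap : (StarAlgebra.adjoin ℂ (⋃ x : V, Set.range (site (d := d) x))).map
      (quasiLocalSubalgebra d).subtype =
      StarAlgebra.adjoin ℂ (⋃ x : V, Set.range (siteOp (d := d) x)) := by
    have := StarAlgHom.map_adjoin (quasiLocalSubalgebra d).subtype
      (⋃ x : V, Set.range (site (d := d) x))
    refine this.trans ?_
    rw [Set.image_iUnion]
    congr 1
    refine Set.iUnion_congr fun x => ?_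
    ext b
    constructor
    · rintro ⟨_, ⟨m, rfl⟩, rfl⟩
      exact ⟨m, rfl⟩
    · rintro ⟨m, rfl⟩
      exact ⟨site x m, ⟨m, rfl⟩, rfl⟩
  intro a
  have ha : (a : quasiLocalSubalgebra d).1 ∈
      closure ((StarAlgebra.adjoin ℂ (⋃ x : V, Set.range (siteOp (d := d) x)) : Set _)) := a.2
  rw [← hmap] at ha
  have hind : Topology.IsInducing (Subtype.val : quasiLocalSubalgebra d → _) :=
    Topology.IsInducing.subtypeVal
  exact (hind.closure_eq_preimage_closure_image
    (StarAlgebra.adjoin ℂ (⋃ x : V, Set.range (site (d := d) x)) : Set (QuasiLocal d))).symm ▸ ha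

variable (d) in
lemma dense_span_siteProd :
    Dense (Submodule.span ℂ {a | ∃ s m, a = siteProd (d := d) s m} : Set (QuasiLocal d)) :=
  (dense_adjoin_site d).mono (adjoin_site_le_span d)

/-- Continuous linear functionals are determined by their values on products. -/
lemma ext_of_siteProd {f g : StrongDual ℂ (QuasiLocal d)}
    (h : ∀ s m, f (siteProd s m) = g (siteProd s m)) : f = g := by
  refine ContinuousLinearMap.ext_on (dense_span_siteProd d) ?_
  rintro _ ⟨s, m, rfl⟩
  exact h s m

variable (d) in
lemma dense_local : Dense {a : QuasiLocal d | ∃ s : Finset V, a ∈ loc (d := d) (s : Set V)} := by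
  classical
  refine (dense_span_siteProd d).mono fun a ha => ?_
  induction ha using Submodule.span_induction with
  | mem a ha =>
    obtain ⟨s, m, rfl⟩ := ha
    exact ⟨s, siteProd_mem_loc s m⟩
  | zero => exact ⟨∅, zero_mem _⟩
  | add a b _ _ ha hb =>
    obtain ⟨s, hs⟩ := ha
    obtain ⟨t, ht⟩ := hb
    exact ⟨s ∪ t, add_mem (loc_mono (by simp) hs) (loc_mono (by simp) ht)⟩
  | smul c a _ ha =>
    obtain ⟨s, hs⟩ := ha
    exact ⟨s, SMulMemClass.smul_mem _ hs⟩

/-! ### Limits of nets of states -/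

/-- A net of states, indexed by the finite sets, which is eventually constant on each local
element converges to a state. -/
lemma exists_weakStarTendsto (ω : Finset V → StrongDual ℂ (QuasiLocal d))
    (hω : ∀ Λ, IsState (ω Λ : QuasiLocal d →ₗ[ℂ] ℂ))
    (h : ∀ (s : Finset V), ∀ a ∈ loc (d := d) (s : Set V), ∃ Λ₁, ∀ Λ, Λ₁ ⊆ Λ → ω Λ a = ω Λ₁ a) :
    ∃ φ : StrongDual ℂ (QuasiLocal d), WeakStarTendsto Filter.atTop ω φ ∧
      IsState (φ : QuasiLocal d →ₗ[ℂ] ℂ) := by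
  classical
  have hlim (a : QuasiLocal d) : ∃ c, Filter.Tendsto (fun Λ => ω Λ a) Filter.atTop (𝓝 c) := by
    refine cauchySeq_tendsto_of_complete (Metric.cauchySeq_iff'.2 fun ε hε => ?_)
    obtain ⟨b, ⟨s, hs⟩, hb⟩ := (dense_local d).exists_dist_lt a (half_pos hε)
    obtain ⟨Λ₁, hΛ₁⟩ := h s b hs
    refine ⟨Λ₁, fun Λ hΛ => ?_⟩
    have h1 : dist (ω Λ a) (ω Λ b) ≤ dist a b := by
      rw [dist_eq_norm, dist_eq_norm, ← map_sub]
      exact (hω Λ).norm_le _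
    have h2 : dist (ω Λ₁ b) (ω Λ₁ a) ≤ dist a b := by
      rw [dist_comm a, dist_eq_norm, dist_eq_norm, ← map_sub]
      exact (hω Λ₁).norm_le _
    calc _ ≤ dist (ω Λ a) (ω Λ b) + dist (ω Λ b) (ω Λ₁ a) := dist_triangle _ _ _
      _ ≤ dist a b + dist a b := by
          exact add_le_add h1 ((hΛ₁ Λ hΛ).symm ▸ h2)
      _ < ε := by linarith
  choose f hf using hlim
  let F : QuasiLocal d →ₗ[ℂ] ℂ := linearMapOfTendsto (l := Filter.atTop) f
    (fun Λ => (ω Λ : QuasiLocal d →ₗ[ℂ] ℂ)) (tendsto_pi_nhds.2 hf)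
  have hF (a : QuasiLocal d) : F a = f a := rfl
  let φ : StrongDual ℂ (QuasiLocal d) := F.mkContinuous 1 fun a => by
    rw [one_mul, hF]
    exact le_of_tendsto (hf a).norm (Filter.Eventually.of_forall fun Λ => (hω Λ).norm_le a)
  have hφ (a : QuasiLocal d) : φ a = f a := rfl
  refine ⟨φ, ?_, ?_, fun a => ?_⟩
  · exact _root_.tendsto_iff_forall_eval_tendsto_topDualPairing.2 hf
  · refine tendsto_nhds_unique (hf 1) ?_
    have (Λ : Finset V) : ω Λ 1 = 1 := (hω Λ).1
    simp only [this]
    exact tendsto_const_nhds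
  · exact ge_of_tendsto (hf _) (Filter.Eventually.of_forall fun Λ => (hω Λ).2 a)

lemma WeakStarTendsto.apply {ι : Type*} {l : Filter ι} {ω : ι → StrongDual ℂ (QuasiLocal d)}
    {φ : StrongDual ℂ (QuasiLocal d)} (h : WeakStarTendsto l ω φ) (a : QuasiLocal d) :
    Filter.Tendsto (fun i => ω i a) l (𝓝 (φ a)) :=
  _root_.tendsto_iff_forall_eval_tendsto_topDualPairing.1 h a

end States

/-! ### The product state -/

section Product

variable {V : Type u} {d : V → ℕ}

open Classical in
/-- The vector functional of the basis vector at the configuration `σ`. -/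
def vectorFunctional (σ : Config d) : StrongDual ℂ (QuasiLocal d) :=
  LinearMap.mkContinuous
    { toFun := fun a => (a : quasiLocalSubalgebra d).1 (lp.single 2 σ (1 : ℂ)) σ
      map_add' := fun _ _ => rfl
      map_smul' := fun _ _ => rfl }
    1 fun a => by
      refine (lp.norm_apply_le_norm (by norm_num) _ _).trans ?_
      refine (ContinuousLinearMap.le_opNorm _ _).trans ?_
      rw [lp.norm_single (by norm_num), norm_one, mul_one, one_mul]
      rfl

open Classical in
lemma isState_vectorFunctional (σ : Config d) :
    IsState (vectorFunctional σ : QuasiLocal d →ₗ[ℂ] ℂ) := by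
  have hinner (f : ConfigSpace d) : f σ = inner ℂ (lp.single 2 σ (1 : ℂ)) f := by
    rw [lp.inner_single_left]
    simp
  have hpos (f : ConfigSpace d) : (0 : ℂ) ≤ inner ℂ f f := by
    rw [inner_self_eq_norm_sq_to_K]
    exact pow_nonneg (Complex.zero_le_real.2 (norm_nonneg f)) 2
  refine ⟨?_, fun a => ?_⟩
  · change (lp.single 2 σ (1 : ℂ) : ConfigSpace d) σ = 1
    simp
  · change 0 ≤ (star (a : quasiLocalSubalgebra d).1 ((a : quasiLocalSubalgebra d).1
      (lp.single 2 σ (1 : ℂ)))) σ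
    rw [hinner, ContinuousLinearMap.star_eq_adjoint, ContinuousLinearMap.adjoint_inner_right]
    exact hpos _

variable {φ : ∀ x, SiteAlg d x →ₗ[ℂ] ℂ}

/-- Only the trivial algebra has no state: the Hilbert spaces at the sites are nonzero. -/
lemma nonempty_config (hφ : ∀ x, IsState (φ x)) : Nonempty (Config d) := by
  refine ⟨fun x => Classical.choice ?_⟩
  by_contra h
  rw [not_nonempty_iff] at h
  have h1 := (hφ x).1
  rw [Subsingleton.elim (1 : SiteAlg d x) 0, map_zero] at h1
  exact zero_ne_one h1

lemma apply_siteProd {X : Type*} [AddCommGroup X] [Module ℂ X] (F : QuasiLocal d →ₗ[ℂ] X)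
    (s : Finset V) (m : ∀ x, SiteAlg d x) (hF : ∀ x ∈ s, ∀ a, F (condSite φ x a) = F a) :
    F (siteProd s m) = (∏ x ∈ s, φ x (m x)) • F 1 := by
  classical
  induction s using Finset.induction_on with
  | empty =>
    rw [Finset.prod_empty, one_smul]
    rfl
  | insert x s hx ih =>
    rw [siteProd_insert hx, Finset.prod_insert hx, ← hF x (Finset.mem_insert_self x s),
      condSite_site_mul φ x (m x) _ fun n =>
        commute_site_of_mem_loc (by simpa using hx) n (siteProd_mem_loc s m),
      map_smul, ih fun y hy => hF y (Finset.mem_insert_of_mem hy), smul_smul]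

/-- A product state is invariant under the conditional expectations. -/
lemma IsProductState.apply_condSite (hφ : ∀ x, IsState (φ x)) {ω : StrongDual ℂ (QuasiLocal d)}
    (h : IsProductState φ ω) (x : V) (a : QuasiLocal d) : ω (condSite φ x a) = ω a := by
  classical
  suffices hs : ω ∘L condSite φ x = ω from DFunLike.congr_fun hs a
  refine ext_of_siteProd fun s m => ?_
  rw [ContinuousLinearMap.comp_apply]
  have hω (s : Finset V) : ω (siteProd s m) = ∏ x ∈ s, φ x (m x) := h.2 s m
  by_cases hx : x ∈ s
  · rw [← Finset.insert_erase hx]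
    have hx' := Finset.notMem_erase x s
    rw [hω, Finset.prod_insert hx', siteProd_insert hx', condSite_site_mul φ x (m x) _ fun n =>
        commute_site_of_mem_loc (by simp) n (siteProd_mem_loc _ m), map_smul, hω, smul_eq_mul]
  · rw [condSite_of_commute hφ x fun n =>
      commute_site_of_mem_loc (by simpa using hx) n (siteProd_mem_loc s m)]

lemma condExp_eq_of_mem_loc (hφ : ∀ x, IsState (φ x)) {s Λ : Finset V} (h : s ⊆ Λ)
    {a : QuasiLocal d} (ha : a ∈ loc (s : Set V)) : condExp φ Λ a = condExp φ s a := by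
  rw [← apply_condExp φ (condExp φ Λ) s fun x hx a => condExp_condSite hφ (h hx) a]
  have h1 : condExp φ s a ∈ loc (d := d) (∅ : Set V) := by
    simpa using condExp_mem_loc φ s ha
  have := condExp_mul_mul φ (Λ := Λ) (Set.empty_disjoint _) h1 (one_mem _) 1
  rwa [mul_one, mul_one, condExp_one hφ, mul_one, mul_one] at this

/-- The product state exists: it is the limit of the functionals that integrate out finitely many
sites and then apply a fixed state. -/
lemma existsUnique_isProductState (hφ : ∀ x, IsState (φ x)) :
    ∃! ω : StrongDual ℂ (QuasiLocal d), IsProductState φ ω := by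
  obtain ⟨σ⟩ := nonempty_config hφ
  have hv := isState_vectorFunctional σ
  obtain ⟨ω, hlim, hω⟩ := exists_weakStarTendsto
    (fun Λ => vectorFunctional σ ∘L condExp φ Λ)
    (fun Λ => ⟨by
      change vectorFunctional σ (condExp φ Λ 1) = 1
      rw [condExp_one hφ]
      exact hv.1, fun a => hv.nonneg (condExp_nonneg hφ Λ (star_mul_self_nonneg a))⟩)
    (fun s a ha => ⟨s, fun Λ hΛ => by
      change vectorFunctional σ (condExp φ Λ a) = vectorFunctional σ (condExp φ s a)
      rw [condExp_eq_of_mem_loc hφ hΛ ha]⟩)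
  have hprod (s : Finset V) (m : ∀ x, SiteAlg d x) : ω (siteProd s m) = ∏ x ∈ s, φ x (m x) := by
    refine tendsto_nhds_unique (hlim.apply (siteProd s m)) ?_
    refine tendsto_const_nhds.congr' ?_
    filter_upwards [Filter.eventually_ge_atTop s] with Λ hΛ
    have := apply_siteProd (condExp φ Λ : QuasiLocal d →ₗ[ℂ] QuasiLocal d) s m
      fun x hx a => condExp_condSite hφ (hΛ hx) a
    change _ = vectorFunctional σ (condExp φ Λ (siteProd s m))
    change condExp φ Λ (siteProd s m) = _ • condExp φ Λ 1 at this
    have h1 : vectorFunctional σ 1 = 1 := hv.1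
    rw [this, condExp_one hφ, map_smul, h1, smul_eq_mul, mul_one]
  exact ⟨ω, ⟨hω, hprod⟩, fun ω' hω' =>
    ext_of_siteProd fun s m => (hω'.2 s m).trans (hprod s m).symm⟩

end Product

/-! ### Boundaries and exhaustion -/

section Graph

variable {V : Type u} {G : SimpleGraph V} [G.LocallyFinite]

lemma mem_closureFin {Λ : Finset V} {x : V} :
    x ∈ closureFin G Λ ↔ x ∈ Λ ∨ ∃ y ∈ Λ, G.Adj y x := by
  classical
  simp only [closureFin, extBoundary, Finset.mem_union, Finset.mem_sdiff, Finset.mem_biUnion,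
    SimpleGraph.mem_neighborFinset]
  tauto

lemma mem_plaquette {x y : V} : x ∈ plaquette G y ↔ x = y ∨ G.Adj y x := by
  classical
  simp only [plaquette, Finset.mem_insert, SimpleGraph.mem_neighborFinset]

lemma subset_closureFin (Λ : Finset V) : Λ ⊆ closureFin G Λ :=
  fun _ hx => mem_closureFin.2 (Or.inl hx)

lemma closureFin_mono {Λ Γ : Finset V} (h : Λ ⊆ Γ) : closureFin G Λ ⊆ closureFin G Γ := by
  intro x hx
  rcases mem_closureFin.1 hx with hx | ⟨y, hy, hyx⟩
  · exact mem_closureFin.2 (Or.inl (h hx))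
  · exact mem_closureFin.2 (Or.inr ⟨y, h hy, hyx⟩)

lemma plaquette_subset_closureFin {Λ : Finset V} {y : V} (hy : y ∈ Λ) :
    plaquette G y ⊆ closureFin G Λ := by
  intro x hx
  rcases mem_plaquette.1 hx with rfl | h
  · exact mem_closureFin.2 (Or.inl hy)
  · exact mem_closureFin.2 (Or.inr ⟨y, hy, h⟩)

lemma disjoint_plaquette {Λ : Finset V} {y : V} (hy : y ∉ closureFin G Λ) :
    Disjoint (plaquette G y : Set V) (Λ : Set V) := by
  rw [Set.disjoint_left]
  intro x hx hxΛ
  rcases mem_plaquette.1 hx with rfl | h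
  · exact hy (mem_closureFin.2 (Or.inl hxΛ))
  · exact hy (mem_closureFin.2 (Or.inr ⟨x, hxΛ, h.symm⟩))

lemma mem_of_mem_closureFin {y₁ : V} {Λ : ℕ → Finset V} (h : IsAdmissible G y₁ Λ) {n : ℕ} {x : V}
    (hx : x ∈ closureFin G (Λ n)) (hx' : x ∈ tessellation G y₁) : x ∈ Λ n := by
  classical
  by_contra hn
  refine h.boundary_disjoint n x ?_ hx'
  rw [closureFin, Finset.mem_union] at hx
  exact hx.resolve_left hn

open Classical in
lemma IsAdmissible.mem_succ_iff {y₁ : V} {Λ : ℕ → Finset V}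
    (hΛ : IsAdmissible G y₁ Λ) (n : ℕ) {y : V} (hy : y ∈ tessellation G y₁) :
    y ∈ Λ (n + 1) ↔ y ∈ Λ (n + 1) \ closureFin G (Λ n) ∨ y ∈ Λ n := by
  rw [Finset.mem_sdiff]
  constructor
  · intro h1
    by_cases h2 : y ∈ closureFin G (Λ n)
    · exact Or.inr (mem_of_mem_closureFin hΛ h2 hy)
    · exact Or.inl ⟨h1, h2⟩
  · rintro (h1 | h1)
    · exact h1.1
    · exact hΛ.closure_subset n (subset_closureFin _ h1)

/-- The sets of an admissible sequence exhaust a connected graph. -/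
lemma IsAdmissible.tendsto {y₁ : V} {Λ : ℕ → Finset V} (h : IsAdmissible G y₁ Λ)
    (hG : G.Connected) : Filter.Tendsto Λ Filter.atTop Filter.atTop := by
  refine Filter.tendsto_atTop_finset_of_monotone
    (monotone_nat_of_le_succ fun n => (subset_closureFin _).trans (h.closure_subset n)) fun x => ?_
  obtain ⟨n, v, hv⟩ := h.nonempty
  obtain ⟨p⟩ := hG.preconnected v x
  induction p generalizing n with
  | nil => exact ⟨n, hv⟩
  | cons hadj _ ih =>
    exact ih (n + 1) (h.closure_subset n (mem_closureFin.2 (Or.inr ⟨_, hv, hadj⟩)))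

end Graph

lemma commProd_mem {ι M S : Type*} [Monoid M] [SetLike S M] [SubmonoidClass S M] (T : S)
    {s : Finset ι} {f : ι → M} (h : ∀ i ∈ s, f i ∈ T) : commProd s f ∈ T := by
  rw [commProd]
  split_ifs with hc
  · exact Finset.noncommProd_induction s f hc (· ∈ T) (fun _ _ => mul_mem) (one_mem T) h
  · exact one_mem T

lemma commProd_eq {ι M : Type*} [Monoid M] {s : Finset ι} {f : ι → M}
    (h : (s : Set ι).Pairwise (Function.onFun Commute f)) :
    commProd s f = s.noncommProd f h := dif_pos h

/-! ### Plaquette amplitudes -/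

section Amplitude

variable {V : Type u} {G : SimpleGraph V} [G.LocallyFinite] {y₁ : V} {d : V → ℕ}
  {φ : ∀ x, SiteAlg d x →ₗ[ℂ] ℂ} {K : V → V → QuasiLocal d}

variable (G y₁ φ K) in
/-- The standing assumptions on the tessellation, the states and the operators `K y x`. -/
structure IsAmplitudeSystem : Prop where
  isState : ∀ x, IsState (φ x)
  notMem_plaquette : ∀ y ∈ tessellation G y₁, ∀ z ∈ tessellation G y₁, y ≠ z → y ∉ plaquette G z
  mem_loc : ∀ y ∈ tessellation G y₁, ∀ x, G.Adj y x → K y x ∈ loc (d := d) {x, y}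
  isUnit : ∀ y ∈ tessellation G y₁, ∀ x, G.Adj y x → IsUnit (K y x)
  commute : ∀ a ∈ amplitudeAlgebra G y₁ K, ∀ b ∈ amplitudeAlgebra G y₁ K, Commute a b
  normalizer_commute : ∀ y ∈ tessellation G y₁, ∀ a ∈ amplitudeAlgebra G y₁ K,
    Commute (normalizer G φ K y) a

lemma mem_amplitudeAlgebra {y : V} (hy : y ∈ tessellation G y₁) {x : V} (hx : G.Adj y x) :
    K y x ∈ amplitudeAlgebra G y₁ K :=
  StarSubalgebra.le_topologicalClosure _ (StarAlgebra.subset_adjoin ℂ _ ⟨y, hy, x, hx, rfl⟩)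

lemma starProd_mem_amplitudeAlgebra {y : V} (hy : y ∈ tessellation G y₁) :
    starProd G K y ∈ amplitudeAlgebra G y₁ K :=
  commProd_mem _ fun _ hx => mem_amplitudeAlgebra hy ((G.mem_neighborFinset y _).1 hx)

open Classical in
lemma amplitude_of_notMem {Λ : Finset V} {y : V}
    (hy : y ∉ tessellation G y₁) :
    amplitude G y₁ φ K Λ = amplitude G y₁ φ K (Λ.erase y) := by
  have hset : Λ.filter (· ∈ tessellation G y₁) =
      (Λ.erase y).filter (· ∈ tessellation G y₁) := by
    ext z
    simp only [Finset.mem_filter, Finset.mem_erase]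
    constructor
    · rintro ⟨h1, h2⟩
      exact ⟨⟨fun e => hy (e ▸ h2), h1⟩, h2⟩
    · rintro ⟨⟨-, h1⟩, h2⟩
      exact ⟨h1, h2⟩
  rw [amplitude, amplitude, hset]

lemma amplitude_empty : amplitude G y₁ φ K ∅ = 1 := by
  rw [amplitude, Finset.filter_empty, commProd_eq (by simp), Finset.noncommProd_empty]

lemma perturbed_apply (ω : StrongDual ℂ (QuasiLocal d)) (Λ : Finset V)
    (a : QuasiLocal d) : perturbed G y₁ φ K ω Λ a =
      ω (star (amplitude G y₁ φ K Λ) * a * amplitude G y₁ φ K Λ) := by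
  simp [perturbed]

open Classical in
lemma transition_apply {Λ₁ Λ₂ : Finset V} (a : QuasiLocal d) :
    transition G y₁ φ K Λ₁ Λ₂ a = condExp φ (Λ₂ \ closureFin G Λ₁)
      (star (amplitude G y₁ φ K (Λ₂ \ closureFin G Λ₁)) * a *
        amplitude G y₁ φ K (Λ₂ \ closureFin G Λ₁)) := by
  simp [transition]

open Classical in
lemma localTransition_apply {Λ₁ Λ₂ : Finset V} (a : QuasiLocal d) :
    localTransition G y₁ φ K Λ₁ Λ₂ a = condExp φ (closureFin G Λ₂ \ closureFin G Λ₁)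
      (star (amplitude G y₁ φ K (Λ₂ \ closureFin G Λ₁)) * a *
        amplitude G y₁ φ K (Λ₂ \ closureFin G Λ₁)) := by
  simp [localTransition]

lemma backwardComp_eq {ω : Finset V → StrongDual ℂ (QuasiLocal d)}
    {Λ : ℕ → Finset V} {E : ℕ → QuasiLocal d →L[ℂ] QuasiLocal d}
    (h : ∀ n, ω (Λ n) ∘L E n = ω (Λ (n + 1))) (n : ℕ) :
    backwardComp (ω (Λ 0)) E n = ω (Λ (n + 1)) := by
  induction n with
  | zero => exact h 0
  | succ n ih => rw [backwardComp, ih, h]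

lemma WeakStarTendsto.backwardComp_of_comp_eq
    {ω : Finset V → StrongDual ℂ (QuasiLocal d)} {ψ : StrongDual ℂ (QuasiLocal d)}
    (hlim : WeakStarTendsto Filter.atTop ω ψ) {Λ : ℕ → Finset V}
    (hΛ : Filter.Tendsto Λ Filter.atTop Filter.atTop)
    {E : ℕ → QuasiLocal d →L[ℂ] QuasiLocal d} (h : ∀ n, ω (Λ n) ∘L E n = ω (Λ (n + 1))) :
    WeakStarTendsto Filter.atTop (backwardComp (ω (Λ 0)) E) ψ := by
  rw [show backwardComp (ω (Λ 0)) E = fun n => ω (Λ (n + 1)) from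
    funext (backwardComp_eq h)]
  exact Filter.Tendsto.comp (g := fun Λ => StrongDual.toWeakDual (ω Λ)) hlim 
    (hΛ.comp (Filter.tendsto_add_atTop_nat 1))

namespace IsAmplitudeSystem

lemma starProd_mem_loc (h : IsAmplitudeSystem G y₁ φ K) {y : V} (hy : y ∈ tessellation G y₁) :
    starProd G K y ∈ loc (d := d) (plaquette G y : Set V) := by
  refine commProd_mem _ fun x hx => ?_
  rw [SimpleGraph.mem_neighborFinset] at hx
  refine loc_mono ?_ (h.mem_loc y hy x hx)
  rintro z (rfl | rfl)
  · exact mem_plaquette.2 (Or.inr hx)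
  · exact mem_plaquette.2 (Or.inl rfl)

lemma isUnit_starProd (h : IsAmplitudeSystem G y₁ φ K) {y : V} (hy : y ∈ tessellation G y₁) :
    IsUnit (starProd G K y) :=
  commProd_mem (IsUnit.submonoid (QuasiLocal d)) fun x hx =>
    h.isUnit y hy x ((G.mem_neighborFinset y x).1 hx)

lemma nontrivial (h : IsAmplitudeSystem G y₁ φ K) : Nontrivial (QuasiLocal d) := by
  obtain ⟨ω, hω, -⟩ := existsUnique_isProductState h.isState
  refine ⟨1, 0, fun e => ?_⟩
  have h1 : ω 1 = 1 := hω.1.1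
  rw [e, map_zero] at h1
  exact zero_ne_one h1

lemma isSelfAdjoint_normalizer (h : IsAmplitudeSystem G y₁ φ K) (y : V) :
    IsSelfAdjoint (normalizer G φ K y) :=
  (condSite_nonneg h.isState y (star_mul_self_nonneg _)).isSelfAdjoint

/-- The normalization is bounded below, since `∏ K y x` is invertible. -/
lemma spectrum_normalizer_pos (h : IsAmplitudeSystem G y₁ φ K) {y : V}
    (hy : y ∈ tessellation G y₁) {t : ℝ} (ht : t ∈ spectrum ℝ (normalizer G φ K y)) : 0 < t := by
  have := h.nontrivial
  set P := starProd G K y with hP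
  have hunit : IsUnit (star P * P) := (h.isUnit_starProd hy).star.mul (h.isUnit_starProd hy)
  have hnn : 0 ≤ star P * P := star_mul_self_nonneg P
  obtain ⟨r, hr, hle⟩ := (CFC.exists_pos_algebraMap_le_iff hnn.isSelfAdjoint).2 fun x hx =>
    lt_of_le_of_ne (spectrum_nonneg_of_nonneg hnn hx) fun e =>
      spectrum.zero_notMem ℝ hunit (e ▸ hx)
  refine (CFC.exists_pos_algebraMap_le_iff (h.isSelfAdjoint_normalizer y)).1 ⟨r, hr, ?_⟩ t ht
  have h1 := condSite_nonneg h.isState y (sub_nonneg.2 hle)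
  rw [map_sub, condSite_of_commute h.isState y fun n =>
    (Algebra.commutes' r (site y n)).symm] at h1
  exact sub_nonneg.1 h1

lemma normalizer_mem_loc (h : IsAmplitudeSystem G y₁ φ K) {y : V} (hy : y ∈ tessellation G y₁) :
    normalizer G φ K y ∈ loc (d := d) ((plaquette G y : Set V) \ {y}) :=
  condSite_mem_loc φ y (mul_mem (star_mem (h.starProd_mem_loc hy)) (h.starProd_mem_loc hy))

lemma plaquetteAmplitude_mem_loc (h : IsAmplitudeSystem G y₁ φ K) {y : V}
    (hy : y ∈ tessellation G y₁) :
    plaquetteAmplitude G φ K y ∈ loc (d := d) (plaquette G y : Set V) := by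
  have : IsClosed (loc (d := d) (plaquette G y : Set V) : Set (QuasiLocal d)) := isClosed_loc _
  exact mul_mem (h.starProd_mem_loc hy)
    (cfc_mem (𝕜' := ℂ) _ (loc_mono Set.sdiff_subset (h.normalizer_mem_loc hy)))

/-- The normalization makes `𝔼⁰_{{y}ᶜ}(|K_y|²) = 1`. -/
lemma condSite_star_mul_self (h : IsAmplitudeSystem G y₁ φ K) {y : V}
    (hy : y ∈ tessellation G y₁) :
    condSite φ y (star (plaquetteAmplitude G φ K y) * plaquetteAmplitude G φ K y) = 1 := by
  set f : ℝ → ℝ := fun t => t ^ (-(1 / 2) : ℝ) with hf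
  set B := normalizer G φ K y with hB
  have : IsSelfAdjoint B := h.isSelfAdjoint_normalizer y
  have hsite (n : SiteAlg d y) : Commute (site y n) (cfc f B) :=
    ((commute_site_condSite φ y n _).symm.cfc_real f).symm
  have hcont : ContinuousOn f (spectrum ℝ B) :=
    continuousOn_id.rpow_const fun t ht => Or.inl (h.spectrum_normalizer_pos hy ht).ne'
  have hmul : cfc f B * B * cfc f B = 1 := by
    conv_lhs => enter [1, 2]; rw [← cfc_id' ℝ B]
    rw [← cfc_mul f (fun t => t) B, ← cfc_mul _ f B, ← cfc_one ℝ B]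
    refine cfc_congr fun t ht => ?_
    have ht0 := h.spectrum_normalizer_pos hy ht
    simp only [hf, Pi.one_apply]
    rw [mul_right_comm, ← Real.rpow_add ht0]
    norm_num
    rw [Real.rpow_neg_one, inv_mul_cancel₀ ht0.ne']
  have hN : star (cfc f B) = cfc f B := (IsSelfAdjoint.cfc (f := f) (a := B)).star_eq
  calc _ = condSite φ y (cfc f B * (star (starProd G K y) * starProd G K y) * cfc f B) := by
        rw [show plaquetteAmplitude G φ K y = starProd G K y * cfc f B from rfl, star_mul, hN]
        simp only [mul_assoc]
    _ = cfc f B * B * cfc f B := condSite_mul_mul φ y hsite hsite _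
    _ = 1 := hmul

lemma commute_normalizer (h : IsAmplitudeSystem G y₁ φ K) {y z : V} (hy : y ∈ tessellation G y₁)
    (hz : z ∈ tessellation G y₁) : Commute (normalizer G φ K y) (normalizer G φ K z) := by
  rcases eq_or_ne y z with rfl | hyz
  · exact Commute.refl _
  have hs (n : SiteAlg d y) : Commute (site y n) (normalizer G φ K z) :=
    commute_site_of_mem_loc (fun hm => h.notMem_plaquette y hy z hz hyz hm.1) n
      (h.normalizer_mem_loc hz)
  have hP := starProd_mem_amplitudeAlgebra (K := K) hy
  -- `B_z` passes through `𝔼⁰_{{y}ᶜ}` on both sides, and it commutes with the argument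
  have h1 := condSite_mul_mul φ y (fun n => Commute.one_right _) hs
    (star (starProd G K y) * starProd G K y)
  have h2 := condSite_mul_mul φ y hs (fun n => Commute.one_right _)
    (star (starProd G K y) * starProd G K y)
  rw [one_mul, one_mul] at h1
  rw [mul_one, mul_one, (h.normalizer_commute z hz _ (mul_mem (star_mem hP) hP)).eq] at h2
  exact h1.symm.trans h2

lemma commute_of_commute_normalizer {y : V} {a : QuasiLocal d}
    (h1 : Commute (starProd G K y) a) (h2 : Commute (normalizer G φ K y) a) :
    Commute (plaquetteAmplitude G φ K y) a :=
  h1.mul_left (h2.cfc_real _)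

lemma commute_plaquetteAmplitude (h : IsAmplitudeSystem G y₁ φ K) {y z : V}
    (hy : y ∈ tessellation G y₁) (hz : z ∈ tessellation G y₁) :
    Commute (plaquetteAmplitude G φ K y) (plaquetteAmplitude G φ K z) ∧
      Commute (plaquetteAmplitude G φ K y) (star (plaquetteAmplitude G φ K z)) := by
  have hP := starProd_mem_amplitudeAlgebra (K := K) hy
  have hQ := starProd_mem_amplitudeAlgebra (K := K) hz
  set f : ℝ → ℝ := fun t => t ^ (-(1 / 2) : ℝ) with hf
  have hPB : Commute (starProd G K y) (cfc f (normalizer G φ K z)) :=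
    ((h.normalizer_commute z hz _ hP).cfc_real f).symm
  have hBB : Commute (normalizer G φ K y) (cfc f (normalizer G φ K z)) :=
    ((h.commute_normalizer hz hy).cfc_real f).symm
  have hN : star (cfc f (normalizer G φ K z)) = cfc f (normalizer G φ K z) :=
    (IsSelfAdjoint.cfc (f := f) (a := normalizer G φ K z)).star_eq
  refine ⟨commute_of_commute_normalizer ?_ ?_, commute_of_commute_normalizer ?_ ?_⟩
  · exact (h.commute _ hP _ hQ).mul_right hPB
  · exact (h.normalizer_commute y hy _ hQ).mul_right hBB
  · rw [plaquetteAmplitude, star_mul, hN]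
    exact hPB.mul_right (h.commute _ hP _ (star_mem hQ))
  · rw [plaquetteAmplitude, star_mul, hN]
    exact hBB.mul_right (h.normalizer_commute y hy _ (star_mem hQ))

/-! ### Amplitudes of finite sets -/

lemma pairwise_commute (h : IsAmplitudeSystem G y₁ φ K) {s : Finset V}
    (hs : ∀ y ∈ s, y ∈ tessellation G y₁) :
    (s : Set V).Pairwise (Function.onFun Commute (plaquetteAmplitude G φ K)) :=
  fun y hy z hz _ => (h.commute_plaquetteAmplitude (hs y hy) (hs z hz)).1

lemma amplitude_mem_loc (h : IsAmplitudeSystem G y₁ φ K) {Λ : Finset V} {Γ : Set V}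
    (hΓ : ∀ y ∈ Λ, y ∈ tessellation G y₁ → (plaquette G y : Set V) ⊆ Γ) :
    amplitude G y₁ φ K Λ ∈ loc (d := d) Γ := by
  classical
  refine commProd_mem _ fun y hy => ?_
  rw [Finset.mem_filter] at hy
  exact loc_mono (hΓ y hy.1 hy.2) (h.plaquetteAmplitude_mem_loc hy.2)

lemma amplitude_mem_loc_closureFin (h : IsAmplitudeSystem G y₁ φ K) (Λ : Finset V) :
    amplitude G y₁ φ K Λ ∈ loc (d := d) (closureFin G Λ : Set V) :=
  h.amplitude_mem_loc fun _ hy _ => plaquette_subset_closureFin hy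

/-- The amplitude is multiplicative; only the points of `V₀` matter. -/
lemma amplitude_eq_mul (h : IsAmplitudeSystem G y₁ φ K) {Λ Γ₁ Γ₂ : Finset V}
    (hdisj : Disjoint Γ₁ Γ₂)
    (hΛ : ∀ y ∈ tessellation G y₁, y ∈ Λ ↔ y ∈ Γ₁ ∨ y ∈ Γ₂) :
    amplitude G y₁ φ K Λ = amplitude G y₁ φ K Γ₁ * amplitude G y₁ φ K Γ₂ := by
  classical
  have hT (s : Finset V) : ∀ y ∈ s.filter (· ∈ tessellation G y₁), y ∈ tessellation G y₁ :=
    fun y hy => (Finset.mem_filter.1 hy).2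
  have hset : Λ.filter (· ∈ tessellation G y₁) =
      Γ₁.filter (· ∈ tessellation G y₁) ∪ Γ₂.filter (· ∈ tessellation G y₁) := by
    ext y
    have := hΛ y
    simp only [Finset.mem_filter, Finset.mem_union]
    tauto
  have hU : ∀ y ∈ Γ₁.filter (· ∈ tessellation G y₁) ∪ Γ₂.filter (· ∈ tessellation G y₁),
      y ∈ tessellation G y₁ := hset ▸ hT Λ
  have := Finset.noncommProd_union_of_disjoint (Finset.disjoint_filter_filter hdisj)
    (plaquetteAmplitude G φ K) (h.pairwise_commute hU)
  rw [← commProd_eq, ← commProd_eq, ← commProd_eq, ← hset] at this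
  exact this

open Classical in
lemma amplitude_eq_mul_erase (h : IsAmplitudeSystem G y₁ φ K) {Λ : Finset V} {y : V}
    (hy : y ∈ tessellation G y₁) (hyΛ : y ∈ Λ) :
    amplitude G y₁ φ K Λ = plaquetteAmplitude G φ K y * amplitude G y₁ φ K (Λ.erase y) := by
  have h1 : amplitude G y₁ φ K {y} = plaquetteAmplitude G φ K y := by
    rw [amplitude, Finset.filter_singleton, if_pos hy, commProd_eq (by simp),
      Finset.noncommProd_singleton]
  rw [← h1]
  refine h.amplitude_eq_mul (by simp) fun z _ => ?_
  by_cases hz : z = y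
  · simp [hz, hyΛ]
  · simp [hz]

open Classical in
/-- Integrating out a point `y` of `V₀` removes its plaquette amplitude, if the observable does
not touch the plaquette. -/
lemma apply_conj_amplitude_erase (h : IsAmplitudeSystem G y₁ φ K) {X : Type*}
    (F : QuasiLocal d → X) {y : V} (hF : ∀ b, F (condSite φ y b) = F b) {Λ₀ : Set V}
    {a : QuasiLocal d} (ha : a ∈ loc Λ₀)
    (hdisj : y ∈ tessellation G y₁ → Disjoint (plaquette G y : Set V) Λ₀) (Λ : Finset V) :
    F (star (amplitude G y₁ φ K Λ) * a * amplitude G y₁ φ K Λ) =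
      F (star (amplitude G y₁ φ K (Λ.erase y)) * a * amplitude G y₁ φ K (Λ.erase y)) := by
  by_cases hy : y ∈ tessellation G y₁
  swap
  · rw [amplitude_of_notMem hy]
  by_cases hyΛ : y ∈ Λ
  swap
  · rw [Finset.erase_eq_of_notMem hyΛ]
  have hdisj := hdisj hy
  have hk := h.plaquetteAmplitude_mem_loc hy
  have hyΛ₀ : y ∉ Λ₀ := Set.disjoint_left.1 hdisj (mem_plaquette.2 (Or.inl rfl))
  have hcomm : Commute (star (plaquetteAmplitude G φ K y)) a :=
    commute_of_mem_loc hdisj (star_mem hk) ha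
  have hA : amplitude G y₁ φ K (Λ.erase y) ∈ loc (d := d) ({y}ᶜ : Set V) := by
    refine h.amplitude_mem_loc fun z hz hzT w hw => ?_
    rintro rfl
    exact h.notMem_plaquette w hy z hzT (Finset.ne_of_mem_erase hz).symm hw
  have hAa : star (amplitude G y₁ φ K (Λ.erase y)) * a ∈ loc (d := d) ({y}ᶜ : Set V) :=
    mul_mem (star_mem hA) (loc_mono (Set.subset_compl_singleton_iff.2 hyΛ₀) ha)
  have hs {b : QuasiLocal d} (hb : b ∈ loc (d := d) ({y}ᶜ : Set V)) (n : SiteAlg d y) :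
      Commute (site y n) b := commute_site_of_mem_loc (by simp) n hb
  have hre : star (amplitude G y₁ φ K Λ) * a * amplitude G y₁ φ K Λ =
      (star (amplitude G y₁ φ K (Λ.erase y)) * a) *
        (star (plaquetteAmplitude G φ K y) * plaquetteAmplitude G φ K y) *
          amplitude G y₁ φ K (Λ.erase y) := by
    rw [h.amplitude_eq_mul_erase hy hyΛ, star_mul, mul_assoc (star _) _ a, hcomm.eq]
    simp only [mul_assoc]
  rw [hre, ← hF, condSite_mul_mul φ y (hs hAa) (hs hA), h.condSite_star_mul_self hy, mul_one]

open Classical in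
/-- Integrating out a set `Γ` of sites removes the amplitudes of the points of `Γ`. -/
lemma apply_conj_amplitude_sdiff (h : IsAmplitudeSystem G y₁ φ K) {X : Type*}
    (F : QuasiLocal d → X) {Λ₀ : Set V} {a : QuasiLocal d} (ha : a ∈ loc Λ₀) (Γ Λ : Finset V)
    (hF : ∀ y ∈ Γ, ∀ b, F (condSite φ y b) = F b)
    (hdisj : ∀ y ∈ Γ, y ∈ tessellation G y₁ → Disjoint (plaquette G y : Set V) Λ₀) :
    F (star (amplitude G y₁ φ K Λ) * a * amplitude G y₁ φ K Λ) =
      F (star (amplitude G y₁ φ K (Λ \ Γ)) * a * amplitude G y₁ φ K (Λ \ Γ)) := by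
  induction Γ using Finset.induction_on with
  | empty => rw [Finset.sdiff_empty]
  | insert y s hy ih =>
    rw [ih (fun z hz => hF z (Finset.mem_insert_of_mem hz))
      (fun z hz => hdisj z (Finset.mem_insert_of_mem hz)),
      h.apply_conj_amplitude_erase F (hF y (Finset.mem_insert_self y s)) ha
        (hdisj y (Finset.mem_insert_self y s)), Finset.sdiff_insert]

/-- If `F` integrates out the sites of `Λ`, then `|K_Λ|²` is normalized for `F`. -/
lemma apply_conj_amplitude_one (h : IsAmplitudeSystem G y₁ φ K) {X : Type*}
    (F : QuasiLocal d → X) (Λ : Finset V) (hF : ∀ y ∈ Λ, ∀ b, F (condSite φ y b) = F b) :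
    F (star (amplitude G y₁ φ K Λ) * 1 * amplitude G y₁ φ K Λ) = F 1 := by
  classical
  have := h.apply_conj_amplitude_sdiff F (Λ₀ := ∅) (one_mem _) Λ Λ hF fun _ _ _ =>
    Set.disjoint_empty _
  simpa [amplitude_empty] using this

/-! ### Perturbed states -/

lemma isState_perturbed (h : IsAmplitudeSystem G y₁ φ K) {ω : StrongDual ℂ (QuasiLocal d)}
    (hω : IsProductState φ ω) (Λ : Finset V) :
    IsState (perturbed G y₁ φ K ω Λ : QuasiLocal d →ₗ[ℂ] ℂ) := by
  refine ⟨?_, fun a => ?_⟩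
  · change perturbed G y₁ φ K ω Λ 1 = 1
    rw [perturbed_apply,
      h.apply_conj_amplitude_one ω Λ fun y _ b => hω.apply_condSite h.isState y b]
    exact hω.1.1
  · change 0 ≤ perturbed G y₁ φ K ω Λ (star a * a)
    rw [perturbed_apply]
    exact hω.1.nonneg (star_left_conjugate_nonneg (star_mul_self_nonneg a) _)

/-- The perturbed states stabilize on local elements. -/
lemma perturbed_eq (h : IsAmplitudeSystem G y₁ φ K) {ω : StrongDual ℂ (QuasiLocal d)}
    (hω : IsProductState φ ω) {Λ₀ Λ : Finset V} (hΛ : closureFin G Λ₀ ⊆ Λ) {a : QuasiLocal d}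
    (ha : a ∈ loc (d := d) (Λ₀ : Set V)) :
    perturbed G y₁ φ K ω Λ a = perturbed G y₁ φ K ω (closureFin G Λ₀) a := by
  classical
  rw [perturbed_apply, perturbed_apply,
    h.apply_conj_amplitude_sdiff ω ha (Λ \ closureFin G Λ₀) Λ
      (fun y _ b => hω.apply_condSite h.isState y b)
      (fun y hy _ => disjoint_plaquette (Finset.mem_sdiff.1 hy).2),
    Finset.sdiff_sdiff_eq_self hΛ]

/-! ### Transition maps -/

variable {Λ₁ Λ₂ S T : Finset V}

/-- The transition maps have all the properties of a quasi-conditional expectation on the whole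
quasi-local algebra, as soon as `T` contains `S` and misses the closure of `Λ₁`. -/
lemma isQuasiCondExp_top (h : IsAmplitudeSystem G y₁ φ K) {E : QuasiLocal d →L[ℂ] QuasiLocal d}
    (hE : ∀ a, E a = condExp φ T (star (amplitude G y₁ φ K S) * a * amplitude G y₁ φ K S))
    (hST : S ⊆ T) (hT : Disjoint T (closureFin G Λ₁)) :
    IsQuasiCondExp (loc (Λ₁ : Set V)) ⊤ ⊤ E where
  left_le := le_top
  right_le := le_rfl
  mem _ _ := trivial
  map_one := by
    rw [hE, h.apply_conj_amplitude_one (condExp φ T) S fun y hy b =>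
      condExp_condSite h.isState (hST hy) b, condExp_one h.isState]
  completelyPositive k M _ hM := by
    rw [show (E : QuasiLocal d → QuasiLocal d) = _ from funext hE]
    exact (isCompletelyPositive_condExp h.isState T).comp (isCompletelyPositive_conj _) k M hM
  map_mul c hc a _ := by
    have hTΛ : Disjoint (Λ₁ : Set V) (T : Set V) :=
      Finset.disjoint_coe.2 (hT.mono_right (subset_closureFin Λ₁)).symm
    have hS : amplitude G y₁ φ K S ∈ loc (d := d) ((Λ₁ : Set V)ᶜ) :=
      h.amplitude_mem_loc fun y hy _ => Set.subset_compl_iff_disjoint_right.2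
        (disjoint_plaquette (Finset.disjoint_left.1 hT (hST hy)))
    have hcomm : Commute (star (amplitude G y₁ φ K S)) c :=
      commute_of_mem_loc disjoint_compl_left (star_mem hS) hc
    have := condExp_mul_mul φ hTΛ hc (one_mem _)
      (star (amplitude G y₁ φ K S) * a * amplitude G y₁ φ K S)
    rw [mul_one, mul_one] at this
    rw [hE, hE, ← this, ← mul_assoc (star _) c a, hcomm.eq]
    simp only [mul_assoc]

/-- Composition with the transition map passes from the perturbed state of `Λ₁` to the one of
`Λ₂`, if `Λ₂` and `S ∪ Λ₁` contain the same points of `V₀`. -/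
lemma perturbed_transition (h : IsAmplitudeSystem G y₁ φ K) {ω : StrongDual ℂ (QuasiLocal d)}
    (hω : IsProductState φ ω) {E : QuasiLocal d →L[ℂ] QuasiLocal d}
    (hE : ∀ a, E a = condExp φ T (star (amplitude G y₁ φ K S) * a * amplitude G y₁ φ K S))
    (hST : S ⊆ T) (hT : Disjoint T (closureFin G Λ₁))
    (hΛ : ∀ y ∈ tessellation G y₁, y ∈ Λ₂ ↔ y ∈ S ∨ y ∈ Λ₁) :
    perturbed G y₁ φ K ω Λ₁ ∘L E = perturbed G y₁ φ K ω Λ₂ := by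
  ext a
  have hA := h.amplitude_mem_loc_closureFin Λ₁
  rw [ContinuousLinearMap.comp_apply, perturbed_apply, perturbed_apply, hE,
    ← condExp_mul_mul φ (Finset.disjoint_coe.2 hT.symm) (star_mem hA) hA,
    apply_condExp φ ω T fun x _ b => hω.apply_condSite h.isState x b,
    h.amplitude_eq_mul ((hT.mono_left hST).mono_right (subset_closureFin Λ₁)) hΛ, star_mul]
  simp only [mul_assoc]

open Classical in
lemma isQuasiCondExp_transition (h : IsAmplitudeSystem G y₁ φ K) :
    IsQuasiCondExp (loc (Λ₁ : Set V)) ⊤ ⊤ (transition G y₁ φ K Λ₁ Λ₂) :=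
  h.isQuasiCondExp_top transition_apply subset_rfl Finset.sdiff_disjoint

open Classical in
lemma isQuasiCondExp_localTransition (h : IsAmplitudeSystem G y₁ φ K) :
    IsQuasiCondExp (loc (Λ₁ : Set V)) ⊤ ⊤ (localTransition G y₁ φ K Λ₁ Λ₂) :=
  h.isQuasiCondExp_top localTransition_apply
    (Finset.sdiff_subset_sdiff (subset_closureFin Λ₂) subset_rfl) Finset.sdiff_disjoint

lemma isQuasiCondExp_localTransition_loc (h : IsAmplitudeSystem G y₁ φ K)
    (hΛ : closureFin G Λ₁ ⊆ Λ₂) :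
    IsQuasiCondExp (loc (Λ₁ : Set V)) (loc (closureFin G Λ₁ : Set V))
      (loc (closureFin G Λ₂ : Set V)) (localTransition G y₁ φ K Λ₁ Λ₂) where
  left_le := loc_mono (Finset.coe_subset.2 (subset_closureFin Λ₁))
  right_le := loc_mono (Finset.coe_subset.2 (hΛ.trans (subset_closureFin Λ₂)))
  mem a ha := by
    classical
    have hA : amplitude G y₁ φ K (Λ₂ \ closureFin G Λ₁) ∈
        loc (d := d) (closureFin G Λ₂ : Set V) :=
      loc_mono (Finset.coe_subset.2 (closureFin_mono Finset.sdiff_subset))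
        (h.amplitude_mem_loc_closureFin _)
    rw [localTransition_apply]
    refine loc_mono ?_ (condExp_mem_loc φ _ (mul_mem (mul_mem (star_mem hA) ha) hA))
    intro x hx
    by_contra hn
    exact hx.2 (Finset.mem_coe.2 (Finset.mem_sdiff.2 ⟨hx.1, hn⟩))
  map_one := h.isQuasiCondExp_localTransition.map_one
  completelyPositive k M _ hM :=
    h.isQuasiCondExp_localTransition.completelyPositive k M (fun _ _ => trivial) hM
  map_mul c hc a _ := h.isQuasiCondExp_localTransition.map_mul c hc a trivial

end IsAmplitudeSystem

end Amplitude

end QuantumMarkov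

end

/-! ### The Markov field -/

open QuantumMarkov in
/-- Existence of the limit of the perturbed product states, and its backward Markov property with
respect to the tessellation. -/
theorem theorem6p2 {V : Type*} [Infinite V] (G : SimpleGraph V) [G.LocallyFinite]
    (hG : G.Connected) (y₁ : V)
    -- no point of `V₀` lies in the plaquette of another point of `V₀`
    (hV₀ : ∀ y ∈ tessellation G y₁, ∀ z ∈ tessellation G y₁, y ≠ z → y ∉ plaquette G z)
    (d : V → ℕ) (φ : ∀ x, SiteAlg d x →ₗ[ℂ] ℂ) (hφ : ∀ x, IsState (φ x))
    (K : V → V → QuasiLocal d)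
    (hK_mem : ∀ y ∈ tessellation G y₁, ∀ x, G.Adj y x → K y x ∈ loc (d := d) {x, y})
    (hK_unit : ∀ y ∈ tessellation G y₁, ∀ x, G.Adj y x → IsUnit (K y x))
    (hK_comm : ∀ a ∈ amplitudeAlgebra G y₁ K, ∀ b ∈ amplitudeAlgebra G y₁ K, Commute a b)
    (hB : ∀ y ∈ tessellation G y₁, ∀ a ∈ amplitudeAlgebra G y₁ K, Commute (normalizer G φ K y) a) :
    -- the product state exists and is unique
    (∃! φ₀ : StrongDual ℂ (QuasiLocal d), IsProductState φ φ₀) ∧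
    -- the plaquette amplitudes and their adjoints commute
    (∀ y ∈ tessellation G y₁, ∀ z ∈ tessellation G y₁,
      Commute (plaquetteAmplitude G φ K y) (plaquetteAmplitude G φ K z) ∧
      Commute (plaquetteAmplitude G φ K y) (star (plaquetteAmplitude G φ K z))) ∧
    ∀ φ₀ : StrongDual ℂ (QuasiLocal d), IsProductState φ φ₀ →
      (∀ Λ : Finset V, IsState (perturbed G y₁ φ K φ₀ Λ : QuasiLocal d →ₗ[ℂ] ℂ)) ∧
      ∃ ω : StrongDual ℂ (QuasiLocal d),
        -- weak-* convergence of the net, which is eventually constant on local elements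
        WeakStarTendsto Filter.atTop (fun Λ : Finset V => perturbed G y₁ φ K φ₀ Λ) ω ∧
        (∀ Λ₀ : Finset V, ∀ a ∈ loc (d := d) Λ₀, ∀ Λ : Finset V, closureFin G Λ₀ ⊆ Λ →
          perturbed G y₁ φ K φ₀ Λ a = ω a) ∧
        -- the limit is a backward Markov field
        IsBackwardMarkovField G y₁ ω ∧
        -- with explicit quasi-conditional expectations
        ∀ Λ : ℕ → Finset V, IsAdmissible G y₁ Λ →
          (∀ n, IsQuasiCondExp (loc (Λ n)) (loc (closureFin G (Λ n)))
            (loc (closureFin G (Λ (n + 1)))) (localTransition G y₁ φ K (Λ n) (Λ (n + 1)))) ∧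
          (∀ n, IsQuasiCondExp (loc (Λ n)) ⊤ ⊤ (localTransition G y₁ φ K (Λ n) (Λ (n + 1)))) ∧
          (∀ n, IsQuasiCondExp (loc (Λ n)) ⊤ ⊤ (transition G y₁ φ K (Λ n) (Λ (n + 1)))) ∧
          WeakStarTendsto Filter.atTop
            (backwardComp (perturbed G y₁ φ K φ₀ (Λ 0))
              fun n => localTransition G y₁ φ K (Λ n) (Λ (n + 1))) ω ∧
          WeakStarTendsto Filter.atTop
            (backwardComp (perturbed G y₁ φ K φ₀ (Λ 0))
              fun n => transition G y₁ φ K (Λ n) (Λ (n + 1))) ω := by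
  have h : IsAmplitudeSystem G y₁ φ K := ⟨hφ, hV₀, hK_mem, hK_unit, hK_comm, hB⟩
  refine ⟨existsUnique_isProductState hφ,
    fun y hy z hz => h.commute_plaquetteAmplitude hy hz, fun φ₀ hφ₀ => ?_⟩
  obtain ⟨ω, hlim, hω⟩ := exists_weakStarTendsto (fun Λ => perturbed G y₁ φ K φ₀ Λ)
    (h.isState_perturbed hφ₀)
    (fun s a ha => ⟨closureFin G s, fun Λ hΛ => h.perturbed_eq hφ₀ hΛ ha⟩)
  have hloc (Λ : ℕ → Finset V) (hΛ : IsAdmissible G y₁ Λ) :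
      WeakStarTendsto Filter.atTop
        (backwardComp (perturbed G y₁ φ K φ₀ (Λ 0))
          fun n => localTransition G y₁ φ K (Λ n) (Λ (n + 1))) ω := by
    classical
    exact hlim.backwardComp_of_comp_eq (hΛ.tendsto hG) fun n =>
      h.perturbed_transition hφ₀ localTransition_apply
        (Finset.sdiff_subset_sdiff (subset_closureFin _) subset_rfl) Finset.sdiff_disjoint
        fun y hy => hΛ.mem_succ_iff n hy
  refine ⟨h.isState_perturbed hφ₀, ω, hlim, fun Λ₀ a ha Λ hΛ => ?_,
    ⟨hω, fun Λ hΛ => ⟨_, _, h.isState_perturbed hφ₀ (Λ 0),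
      fun n => h.isQuasiCondExp_localTransition_loc (hΛ.closure_subset n),
      fun n => h.isQuasiCondExp_localTransition, hloc Λ hΛ⟩⟩,
    fun Λ hΛ => ⟨fun n => h.isQuasiCondExp_localTransition_loc (hΛ.closure_subset n),
      fun n => h.isQuasiCondExp_localTransition, fun n => h.isQuasiCondExp_transition,
      hloc Λ hΛ, ?_⟩⟩
  · refine tendsto_nhds_unique (tendsto_const_nhds.congr' ?_) (hlim.apply a)
    filter_upwards [Filter.eventually_ge_atTop Λ] with Γ hΓ
    rw [h.perturbed_eq hφ₀ hΛ ha, h.perturbed_eq hφ₀ (hΛ.trans hΓ) ha]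
  · classical
    exact hlim.backwardComp_of_comp_eq (hΛ.tendsto hG) fun n =>
      h.perturbed_transition hφ₀ transition_apply subset_rfl Finset.sdiff_disjoint
        fun y hy => hΛ.mem_succ_iff n hy
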